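/- Let $q>1$ be an integer, $G=(\mathbb{Z}/q\mathbb{Z})^\times$, $s>1$ a real number and $P\ge 2$ a real parameter. Throughout, $p$ denotes a prime number, $\mu$ is the Möbius function, $\exp G$ is the exponent of $G$, and $d(n)$ is the number of positive divisors of $n$. Let $\mathscr{G}$ be the set of cyclic subgroups of $G$. A subset $\mathcal{A}\subset G$ is a lattice-invariant class if it is the set of all generators of some $K\in\mathscr{G}$; let $G^\sharp$ be the set of these classes. The map $\mathcal{A}\mapsto\langle\mathcal{A}\rangle$ (subgroup generated by $\mathcal A$) is a bijection $G^\sharp\to\mathscr{G}$, through which rows and columns indexed by one of these sets may be indexed by the other. For $\mathcal{A}\in G^\sharp$ put $$\zeta_P(s;q,\mathcal{A})=\prod_{p\ge P,\ p\bmod q\in\mathcal{A}}(1-p^{-s})^{-1},\qquad V_s(1)=\bigl(\log\zeta_P(s;q,\mathcal{A})\bigr)_{\mathcal{A}\in G^\sharp}.$$ For a Dirichlet character $\chi$ modulo $q$ put $L_P(s,\chi)=\prod_{p\ge P}(1-\chi(p)/p^s)^{-1}$. For a subgroup $G_0$ of $G$ let $G_0^\perp$ be the group of characters modulo $q$ equal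 to $1$ on $G_0$, and for an integer $t\ge1$ put $$\gamma_s(G_0,t)=\log\prod_{\chi\in G_0^\perp}L_P(ts,\chi),\qquad \Gamma_s(t)=\bigl(\gamma_s(G_0,t)\bigr)_{G_0\in\mathscr{G}}.$$ Let $M_1^{-1}$ be the matrix whose entry at $(\mathcal{A},K)\in G^\sharp\times\mathscr{G}$ is $\mu(|\langle\mathcal{A}\rangle/K|)/|G/K|$ if $K\subset\langle\mathcal{A}\rangle$ and $0$ otherwise. For each divisor $d>1$ of $\exp G$ let $N_d$ be the matrix whose entry at $(B_0,B_1)\in\mathscr{G}\times\mathscr{G}$ is $$\sum_{K\subset B_0,\ |KB_1/K|=d}\mu(|B_0/K|),$$ the sum being over subgroups $K$. For a vector $W$, let $\|W\|=\max_i|W_i|$. Then all the Euler products above converge (those for $L_P$ at the points $ts$ with $t\ge1$ an integer), the products $\prod_{\chi\in G_0^\perp}L_P(ts,\chi)$ are positive real numbers, and for every integer $r\ge2$ $$\Bigl\|V_s(1)-\sum_{0\le v\le r-1}(-1)^v\sum_{d_1\cdots d_v\le 2^r}\frac{N_{d_1}}{d_1}\cdots\frac{N_{d_v}}{d_v}\,M_1^{-1}\,\Gamma_s(d_1\cdots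 d_v)\Bigr\|\le\frac12\Bigl(1+\frac{r-1}{|G^\sharp|}\Bigr)\Bigl(\frac{|G^\sharp|\,d(\exp G)}{2}\Bigr)^{r-1}\frac{1+P/(s2^r-1)}{P^{s2^r}},$$ where the inner sum is over the tuples $(d_1,\dots,d_v)$ of divisors of $\exp G$ other than $1$ with $d_1\cdots d_v\le 2^r$; for $v=0$ the empty product $d_1\cdots d_v$ is $1$ and the empty matrix product is the identity. -/

import Mathlib

open scoped BigOperators

noncomputable section

namespace LatticeEuler

section Group

variable (G : Type) [CommGroup G] [Finite G]

/-- The set of cyclic subgroups of `G`. -/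
abbrev CyclicSubgroup : Type := {K : Subgroup G // IsCyclic K}

/-- The lattice-invariant classes of `G`: the subsets consisting of all the elements of `G` that
generate a given cyclic subgroup. -/
abbrev LatticeClass : Type :=
  {A : Set G // ∃ K : Subgroup G, IsCyclic K ∧ A = {x : G | Subgroup.zpowers x = K}}

instance : Fintype (CyclicSubgroup G) := Fintype.ofFinite _

instance : Fintype (LatticeClass G) := Fintype.ofFinite _

instance : DecidableEq (CyclicSubgroup G) := Classical.decEq _

instance : DecidableEq (LatticeClass G) := Classical.decEq _

instance : Fintype (Subgroup G) := Fintype.ofFinite _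

end Group

section Matrices

variable {G : Type} [CommGroup G]

theorem closure_generators (K : Subgroup G) (hK : IsCyclic K) :
    Subgroup.closure {x : G | Subgroup.zpowers x = K} = K := by
  apply le_antisymm
  · rw [Subgroup.closure_le]
    intro x hx
    have hx' : Subgroup.zpowers x = K := hx
    rw [← hx']
    exact Subgroup.mem_zpowers x
  · obtain ⟨g, hg⟩ := (Subgroup.isCyclic_iff_exists_zpowers_eq_top K).1 hK
    have h1 : g ∈ Subgroup.closure {x : G | Subgroup.zpowers x = K} :=
      Subgroup.subset_closure hg
    calc K = Subgroup.zpowers g := hg.symm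
      _ ≤ _ := by rwa [Subgroup.zpowers_le]

/-- The one-to-one correspondence between lattice-invariant classes and cyclic subgroups:
a class `A` is sent to the subgroup `⟨A⟩` it generates, and a cyclic subgroup to the set of its
generators. -/
def classEquiv : LatticeClass G ≃ CyclicSubgroup G where
  toFun A := ⟨Subgroup.closure A.1, by
    obtain ⟨A, K, hK, rfl⟩ := A
    exact (closure_generators K hK).symm ▸ hK⟩
  invFun K := ⟨{x : G | Subgroup.zpowers x = K.1}, K.1, K.2, rfl⟩
  left_inv := by
    rintro ⟨A, K, hK, rfl⟩
    simp only [closure_generators K hK]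
  right_inv := by
    rintro ⟨K, hK⟩
    simp only [closure_generators K hK]

open Classical in
/-- The matrix `M₁⁻¹`, with rows indexed by classes and columns indexed by cyclic subgroups:
its entry at `(A, K)` is `μ(|⟨A⟩/K|) / |G/K|` when `K ⊆ ⟨A⟩`, and `0` otherwise. -/
def M1Inv : Matrix (LatticeClass G) (CyclicSubgroup G) ℝ := fun A K =>
  if K.1 ≤ Subgroup.closure A.1 then
    ((ArithmeticFunction.moebius (K.1.relIndex (Subgroup.closure A.1)) : ℤ) : ℝ) / (K.1.index : ℝ)
  else 0

open Classical in
/-- The matrix `N_d`, with rows and columns indexed by cyclic subgroups: its entry at `(B₀, B₁)`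
is the sum of `μ(|B₀/K|)` over the subgroups `K ⊆ B₀` such that `|K B₁ / K| = d`. -/
def N [Finite G] (d : ℕ) : Matrix (CyclicSubgroup G) (CyclicSubgroup G) ℝ := fun B₀ B₁ =>
  ∑ K : Subgroup G with K ≤ B₀.1 ∧ K.relIndex (K ⊔ B₁.1) = d,
    ((ArithmeticFunction.moebius (K.relIndex B₀.1) : ℤ) : ℝ)

/-- The matrix `N_d` with its rows and columns indexed by classes, through the correspondence
between classes and cyclic subgroups. -/
def NClass [Finite G] (d : ℕ) : Matrix (LatticeClass G) (LatticeClass G) ℝ :=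
  Matrix.reindex classEquiv.symm classEquiv.symm (N d)

end Matrices

section Euler

/-- The primes `p ≥ P`. -/
abbrev PrimeGE (P : ℝ) : Type := {p : ℕ // p.Prime ∧ P ≤ (p : ℝ)}

/-- The primes `p ≥ P` whose residue class modulo `q` belongs to `A`. -/
abbrev PrimeGEIn (P : ℝ) (q : ℕ) (A : Set (ZMod q)ˣ) : Type :=
  {p : ℕ // p.Prime ∧ P ≤ (p : ℝ) ∧ ∃ a ∈ A, (a : ZMod q) = (p : ZMod q)}

/-- The Euler factor `(1 - p^{-s})⁻¹`. -/
def zetaFactor (s : ℝ) (p : ℕ) : ℝ := (1 - (p : ℝ) ^ (-s))⁻¹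

/-- `ζ_P(s; q, A)`. -/
def zetaP (P : ℝ) (s : ℝ) (q : ℕ) (A : Set (ZMod q)ˣ) : ℝ :=
  ∏' p : PrimeGEIn P q A, zetaFactor s p.1

/-- The Euler factor `(1 - χ(p) / p^s)⁻¹`. -/
def LFactor {q : ℕ} (χ : DirichletCharacter ℂ q) (s : ℂ) (p : ℕ) : ℂ :=
  (1 - χ (p : ZMod q) / (p : ℂ) ^ s)⁻¹

/-- `L_P(s, χ)`. -/
def LP {q : ℕ} (P : ℝ) (s : ℂ) (χ : DirichletCharacter ℂ q) : ℂ :=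
  ∏' p : PrimeGE P, LFactor χ s p.1

variable {q : ℕ} [NeZero q]

open Classical in
/-- `G₀^⊥`: the characters modulo `q` that take the value `1` on `G₀`. -/
def perp (G₀ : Subgroup (ZMod q)ˣ) : Finset (DirichletCharacter ℂ q) :=
  {χ : DirichletCharacter ℂ q | ∀ g ∈ G₀, χ (g : ZMod q) = 1}

/-- The product of the `L_P(t s, χ)` over `χ ∈ G₀^⊥`, as a complex number. -/
def LProd (P s : ℝ) (G₀ : Subgroup (ZMod q)ˣ) (t : ℕ) : ℂ :=
  ∏ χ ∈ perp G₀, LP P (((t : ℝ) * s : ℝ) : ℂ) χ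

/-- `γ_s(G₀, t)`: the logarithm of the product of the `L_P(t s, χ)` over `χ ∈ G₀^⊥`, a product
which is a positive real number when `s > 1` and `t ≥ 1`. -/
def gammaS (P s : ℝ) (G₀ : Subgroup (ZMod q)ˣ) (t : ℕ) : ℝ :=
  Real.log (LProd P s G₀ t).re

/-- The vector `Γ_s(t)`, indexed by cyclic subgroups. -/
def GammaVec (q : ℕ) [NeZero q] (P s : ℝ) (t : ℕ) : CyclicSubgroup (ZMod q)ˣ → ℝ :=
  fun G₀ => gammaS P s G₀.1 t

/-- The vector `V_s(1)`, indexed by lattice-invariant classes. -/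
def VVec (q : ℕ) (P s : ℝ) : LatticeClass (ZMod q)ˣ → ℝ :=
  fun A => Real.log (zetaP P s q A.1)

/-- The tuples `(d₁, …, d_v)` of divisors of `exp G` distinct from `1`, where
`G = (ℤ/qℤ)ˣ`, such that `d₁ ⋯ d_v ≤ z`. -/
def divisorTuples (q v z : ℕ) : Finset (Fin v → ℕ) :=
  (Fintype.piFinset fun _ : Fin v => (Monoid.exponent (ZMod q)ˣ).divisors.erase 1).filter
    fun d => ∏ i, d i ≤ z

/-- The sum over `0 ≤ v ≤ r - 1` of `(-1)^v` times the sum over the tuples `(d₁, …, d_v)` with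
`d₁ ⋯ d_v ≤ 2^r` of `(N_{d₁}/d₁) ⋯ (N_{d_v}/d_v) M₁⁻¹ Γ_s(d₁ ⋯ d_v)`. -/
def approx (q : ℕ) [NeZero q] (P s : ℝ) (r : ℕ) : LatticeClass (ZMod q)ˣ → ℝ :=
  ∑ v ∈ Finset.range r, (-1 : ℝ) ^ v •
    ∑ d ∈ divisorTuples q v (2 ^ r),
      ((List.ofFn fun i : Fin v => ((d i : ℝ)⁻¹) • NClass (G := (ZMod q)ˣ) (d i)).prod
        * M1Inv).mulVec (GammaVec q P s (∏ i, d i))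

end Euler

end LatticeEuler

end

/-! Let `p` be a prime of class `g` modulo `q` and `K` a subgroup. As `χ` runs over `K^⊥`, the
values `χ(g)` run uniformly over the `f`-th roots of unity, with `f = |K⟨g⟩/K|`. The Euler factors
at `p` therefore multiply to `(1 - p^{-fts})^{-|G/K|/f}`. Since `f` depends only on `⟨g⟩`, hence
only on the class of `g`, taking logarithms gives `γ_s(K, t) = ∑_B (|G/K|/f_B) log ζ_P(f_B t s; q,
B)` (`gammaS_eq`); positivity comes from the same computation.

Write `V(x)` for `VVec q P x`. Applying `M₁⁻¹` and sorting by the value `d` of `f_B` gives `M₁⁻¹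
Γ_s(t) = ∑_{d ∣ exp G} (N_d/d) V(dts)`. As `N_1` is the identity, `V(ts)` equals `M₁⁻¹ Γ_s(t)` minus
terms at the farther points `dts`, `d ≥ 2` (`VVec_recursion`). Iterating `r` times, and dropping a
tuple as soon as its product exceeds `2^r`, leaves an exact remainder (`VVec_sub_approx`) made of
values of `V` at points `xs` with `x ≥ 2^r`.

Two facts make the remainder small: the entries of `N_d` are at most `1` in absolute value
(`abs_N_le_one`), by a Möbius cancellation, and the coordinates of `V` together cost a single tail
over primes (`sum_VVec_le`). Tuples of length `r` give the main part of the bound; each of the `r -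
1` smaller lengths costs `1/|G^♯|` of it. -/

noncomputable section

namespace LatticeEuler

/-! ### Euler factors of products over `G₀^⊥` -/

section LocalFactor

/-- A finite product over a group of `1 - φ a * x` only sees the order of the image of `φ`. -/
theorem prod_one_sub_hom_mul {A : Type*} [CommGroup A] [Fintype A] (φ : A →* ℂˣ) (x : ℂ) :
    ∏ a, (1 - (φ a : ℂ) * x) = (1 - x ^ Nat.card φ.range) ^ Nat.card φ.ker := by
  classical
  have h1 := Finset.prod_comp (s := (Finset.univ : Finset A)) (fun y : ℂˣ => 1 - (y : ℂ) * x) φ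
  rw [h1]
  have h2 : ∀ b ∈ Finset.univ.image φ, (Finset.univ.filter fun a => φ a = b).card = Nat.card φ.ker := by
    intro b hb
    obtain ⟨a₀, -, rfl⟩ := Finset.mem_image.1 hb
    rw [← Fintype.card_subtype, ← Nat.card_eq_fintype_card]
    refine Nat.card_congr ((Equiv.mulLeft a₀⁻¹).subtypeEquiv fun a => ?_)
    rw [MonoidHom.mem_ker, Equiv.coe_mulLeft, map_mul, map_inv, inv_mul_eq_one, eq_comm]
  rw [Finset.prod_congr rfl fun b hb => by rw [h2 b hb], Finset.prod_pow]
  congr 1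
  set n := Nat.card φ.range with hn
  have hcard : (Finset.univ.image φ).card = n := by
    rw [hn, ← Set.ncard_coe_finset, ← Nat.card_coe_set_eq, Finset.coe_image, Finset.coe_univ,
      Set.image_univ]
    rfl
  have hn0 : 0 < n := Nat.card_pos
  -- The image has `n` elements, all killed by `n`, so it is the full set of `n`-th roots of unity.
  have himg : (Finset.univ.image φ).image (Units.val : ℂˣ → ℂ) = Polynomial.nthRootsFinset n 1 := by
    apply Finset.eq_of_subset_of_card_le
    · intro y hy
      simp only [Finset.mem_image, Finset.mem_univ, true_and] at hy
      obtain ⟨_, ⟨a, rfl⟩, rfl⟩ := hy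
      rw [Polynomial.mem_nthRootsFinset hn0]
      have : (⟨φ a, a, rfl⟩ : φ.range) ^ n = 1 := pow_card_eq_one'
      have h3 := congrArg (fun z : φ.range => ((z : ℂˣ) : ℂ)) this
      simpa using h3
    · rw [Finset.card_image_of_injective _ Units.val_injective, hcard,
        (Complex.isPrimitiveRoot_exp n hn0.ne').card_nthRootsFinset]
  have h4 := (Complex.isPrimitiveRoot_exp n hn0.ne').pow_sub_pow_eq_prod_sub_mul 1 x hn0
  rw [one_pow, ← himg, Finset.prod_image (fun _ _ _ _ h => Units.val_injective h)] at h4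
  exact h4.symm

variable {q : ℕ} [NeZero q]

theorem mem_perp {G₀ : Subgroup (ZMod q)ˣ} {χ : DirichletCharacter ℂ q} :
    χ ∈ perp G₀ ↔ ∀ g ∈ G₀, χ (g : ZMod q) = 1 := by
  simp [perp]

/-- The local factor of `∏_{χ ∈ G₀^⊥} L(s, χ)` at a prime of class `g`. -/
theorem prod_perp_one_sub (G₀ : Subgroup (ZMod q)ˣ) (g : (ZMod q)ˣ) (x : ℂ) :
    ∃ m : ℕ, m * G₀.relIndex (G₀ ⊔ Subgroup.zpowers g) = G₀.index ∧
    ∏ χ ∈ perp G₀, (1 - χ (g : ZMod q) * x) =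
      (1 - x ^ G₀.relIndex (G₀ ⊔ Subgroup.zpowers g)) ^ m := by
  classical
  set X : Subgroup (DirichletCharacter ℂ q) :=
    (MulChar.subgroupOrderIsoSubgroupMulChar (ZMod q) ℂ G₀).ofDual with hX
  have hXmem : ∀ χ, χ ∈ X ↔ χ ∈ perp G₀ := fun χ => by
    rw [mem_perp, hX, MulChar.mem_subgroupOrderIsoSubgroupMulChar_iff]
  have hXcard : Nat.card X = G₀.index := MulChar.card_subgroupOrderIsoSubgroupMulChar
  have : Fintype X := Fintype.ofFinite X
  let φ : X →* ℂˣ :=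
    { toFun := fun χ => χ.1.toUnitHom g
      map_one' := by ext; simp
      map_mul' := fun a b => by ext; simp }
  have hφ : ∀ χ : X, (φ χ : ℂ) = χ.1 (g : ZMod q) := fun χ => by
    simp [φ]
  -- Duality: an element killed by every character of `G₀^⊥` lies in `G₀`.
  have hker : ∀ k : ℕ, (∀ χ : X, (φ χ) ^ k = 1) ↔ g ^ k ∈ G₀ := by
    intro k
    have h := MulChar.mem_subgroupOrderIsoSubgroupMulChar_symm_iff (M := ZMod q) (R := ℂ) (X := X)
      (m := g ^ k)
    rw [hX, OrderDual.toDual_ofDual, OrderIso.symm_apply_apply, ← hX] at h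
    rw [h]
    simp [Units.ext_iff, hφ]
  have hn : Nat.card φ.range = G₀.relIndex (G₀ ⊔ Subgroup.zpowers g) := by
    -- The range is a finite subgroup of `ℂˣ`, hence cyclic, so its order equals its exponent.
    have h1 : ∀ k : ℕ, Nat.card φ.range ∣ k ↔ g ^ k ∈ G₀ := by
      intro k
      rw [← hker, ← IsCyclic.exponent_eq_card, Monoid.exponent_dvd_iff_forall_pow_eq_one]
      constructor
      · exact fun h χ => congrArg Subtype.val (h ⟨φ χ, χ, rfl⟩)
      · rintro h ⟨_, χ, rfl⟩
        exact Subtype.ext (h χ)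
    have h2 : G₀.relIndex (G₀ ⊔ Subgroup.zpowers g) = orderOf (QuotientGroup.mk' G₀ g) := by
      rw [Subgroup.relIndex_sup_left]
      conv_lhs => rw [← QuotientGroup.ker_mk' G₀]
      rw [Subgroup.relIndex_ker, MonoidHom.map_zpowers, Nat.card_zpowers]
    rw [h2]
    refine Nat.dvd_right_iff_eq.1 fun k => ?_
    rw [h1, orderOf_dvd_iff_pow_eq_one, ← map_pow, QuotientGroup.mk'_apply,
      QuotientGroup.eq_one_iff]
  refine ⟨Nat.card φ.ker, ?_, ?_⟩
  · rw [← hn, ← hXcard, mul_comm, ← Subgroup.index_ker, Subgroup.index_mul_card]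
  · rw [← hn, ← prod_one_sub_hom_mul]
    simp_rw [hφ]
    refine (Finset.prod_subtype (perp G₀) (p := fun χ => χ ∈ X) (fun χ => (hXmem χ).symm)
      (fun χ => 1 - χ (g : ZMod q) * x)) 

end LocalFactor

/-! ### Subgroups of cyclic groups and the entries of `N_d` -/

section Cyclic

variable {G : Type} [CommGroup G] [Finite G]

/-- The number of elements of a cyclic subgroup killed by `n`. -/
theorem card_inf_ker_pow {B : Subgroup G} (hB : IsCyclic B) (n : ℕ) :
    Nat.card ↥(B ⊓ (powMonoidHom n : G →* G).ker) = (Nat.card B).gcd n := by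
  rw [← IsCyclic.card_powMonoidHom_ker]
  have : ((powMonoidHom n : B →* B).ker).map B.subtype = B ⊓ (powMonoidHom n : G →* G).ker := by
    ext x
    simp only [Subgroup.mem_map, MonoidHom.mem_ker, Subgroup.mem_inf, powMonoidHom_apply,
      Subgroup.coe_subtype, Subtype.exists, Subtype.ext_iff]
    constructor
    · rintro ⟨y, hy, h, rfl⟩
      exact ⟨hy, h⟩
    · rintro ⟨h, h'⟩
      exact ⟨x, h, h', rfl⟩
  rw [← this]
  exact Nat.card_congr (Subgroup.equivMapOfInjective _ _ B.subtype_injective).toEquiv.symm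

/-- A subgroup of a cyclic group is determined by its order. -/
theorem eq_inf_ker_pow {B K : Subgroup G} (hB : IsCyclic B) (hK : K ≤ B) :
    K = B ⊓ (powMonoidHom (Nat.card K) : G →* G).ker := by
  apply Subgroup.eq_of_le_of_card_ge
  · refine le_inf hK fun x hx => ?_
    rw [MonoidHom.mem_ker, powMonoidHom_apply]
    exact congrArg Subtype.val (pow_card_eq_one' (x := (⟨x, hx⟩ : K)))
  · rw [card_inf_ker_pow hB]
    exact Nat.gcd_le_right _ Nat.card_pos

/-- Inside `B`, a subgroup of order `k` is the kernel of the `k`-th power map, and two such kernels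
meet in the kernel for the gcd. -/
theorem card_inf_of_le {B K C : Subgroup G} (hB : IsCyclic B) (hK : K ≤ B) (hC : C ≤ B) :
    Nat.card ↥(K ⊓ C) = (Nat.card K).gcd (Nat.card C) := by
  have h : K ⊓ C = B ⊓ (powMonoidHom ((Nat.card K).gcd (Nat.card C)) : G →* G).ker := by
    conv_lhs => rw [eq_inf_ker_pow hB hK, eq_inf_ker_pow hB hC]
    ext x
    simp only [Subgroup.mem_inf, MonoidHom.mem_ker, powMonoidHom_apply,
      ← orderOf_dvd_iff_pow_eq_one, Nat.dvd_gcd_iff]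
    tauto
  rw [h, card_inf_ker_pow hB, Nat.gcd_eq_right]
  exact (Nat.gcd_dvd_left _ _).trans (Subgroup.card_dvd_of_le hK)

open Classical in
/-- Sums over the subgroups of a cyclic group are sums over the divisors of its order. -/
theorem sum_subgroups_eq_sum_divisors {B : Subgroup G} (hB : IsCyclic B) (f : ℕ → ℝ) :
    ∑ K : Subgroup G with K ≤ B, f (Nat.card K) = ∑ k ∈ (Nat.card B).divisors, f k := by
  refine Finset.sum_bij (fun K _ => Nat.card K) ?_ ?_ ?_ ?_
  · intro K hK
    rw [Nat.mem_divisors]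
    exact ⟨Subgroup.card_dvd_of_le (Finset.mem_filter.1 hK).2, Nat.card_pos.ne'⟩
  · intro K hK K' hK' h
    rw [eq_inf_ker_pow hB (Finset.mem_filter.1 hK).2, h,
      ← eq_inf_ker_pow hB (Finset.mem_filter.1 hK').2]
  · intro k hk
    refine ⟨B ⊓ (powMonoidHom k : G →* G).ker, by simp, ?_⟩
    rw [card_inf_ker_pow hB, Nat.gcd_eq_right (Nat.dvd_of_mem_divisors hk)]
  · intros; rfl

theorem sum_divisors_moebius (n : ℕ) :
    ∑ k ∈ n.divisors, (ArithmeticFunction.moebius (n / k) : ℤ) = if n = 1 then 1 else 0 := by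
  rw [Nat.sum_div_divisors n (fun k => (ArithmeticFunction.moebius k : ℤ)),
    ← ArithmeticFunction.coe_mul_zeta_apply, ArithmeticFunction.moebius_mul_coe_zeta,
    ArithmeticFunction.one_apply]

theorem exists_eq_mul_coprime_part {b : ℕ} (hb : b ≠ 0) (c : ℕ) :
    ∃ b₁ b₂, b = b₁ * b₂ ∧ b₂.Coprime c ∧ ∀ p, p.Prime → p ∣ b₁ → p ∣ c := by
  induction b using Nat.strong_induction_on with
  | _ b ih =>
    by_cases h : ∀ p, p.Prime → p ∣ b → p ∣ c
    · exact ⟨b, 1, by simp, by simp, h⟩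
    · push Not at h
      obtain ⟨p, hp, ⟨b', rfl⟩, hpc⟩ := h
      have hb' : b' ≠ 0 := by rintro rfl; simp at hb
      obtain ⟨b₁, b₂, rfl, h2, h3⟩ := ih b'
        (lt_mul_left (Nat.pos_of_ne_zero hb') hp.one_lt) hb'
      exact ⟨b₁, p * b₂, by ring, Nat.Coprime.mul_left ((Nat.Prime.coprime_iff_not_dvd hp).2 hpc) h2,
        h3⟩

/-- Split `b = b₁ b₂` with `b₂` prime to `c` and every prime of `b₁` dividing `c`. The admissible
`k` are the divisors of `b₂`, and `μ(b/k) = μ(b₁) μ(b₂/k)`, so the sum is `μ(b₁)` if `b₂ = 1` and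
`0` otherwise. -/
theorem abs_sum_coprime_moebius_le {b : ℕ} (hb : b ≠ 0) (c : ℕ) :
    |∑ k ∈ b.divisors with k.gcd c = 1, (ArithmeticFunction.moebius (b / k) : ℤ)| ≤ 1 := by
  obtain ⟨b₁, b₂, rfl, h2, h3⟩ := exists_eq_mul_coprime_part hb c
  have hb₁ : b₁ ≠ 0 := by rintro rfl; simp at hb
  have hb₂ : b₂ ≠ 0 := by rintro rfl; simp at hb
  have key : ∀ k : ℕ, k.Coprime c → k.Coprime b₁ := fun k hk =>
    Nat.Coprime.symm <| Nat.coprime_of_dvd fun p hp h h' =>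
      hp.one_lt.ne' (Nat.eq_one_of_dvd_coprimes hk h' (h3 p hp h))
  have hset : {k ∈ (b₁ * b₂).divisors | k.gcd c = 1} = b₂.divisors := by
    ext k
    simp only [Finset.mem_filter, Nat.mem_divisors]
    constructor
    · rintro ⟨⟨h, -⟩, hk⟩
      exact ⟨(key k hk).dvd_of_dvd_mul_left h, hb₂⟩
    · rintro ⟨h, -⟩
      exact ⟨⟨h.mul_left _, hb⟩, Nat.Coprime.coprime_dvd_left h h2⟩
  have hterm : ∀ k ∈ b₂.divisors, (ArithmeticFunction.moebius (b₁ * b₂ / k) : ℤ) =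
      ArithmeticFunction.moebius b₁ * ArithmeticFunction.moebius (b₂ / k) := by
    intro k hk
    have hk := Nat.dvd_of_mem_divisors hk
    rw [Nat.mul_div_assoc _ hk]
    exact ArithmeticFunction.isMultiplicative_moebius.map_mul_of_coprime
      (key _ (Nat.Coprime.coprime_dvd_left (Nat.div_dvd_of_dvd hk) h2)).symm
  rw [hset, Finset.sum_congr rfl hterm, ← Finset.mul_sum, sum_divisors_moebius]
  split_ifs
  · rw [mul_one]
    exact ArithmeticFunction.abs_moebius_le_one
  · simp

theorem sum_gcd_eq_moebius {b c e : ℕ} (he : 0 < e) (hec : e ∣ c) (hcb : c ∣ b) :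
    ∑ k ∈ b.divisors with k.gcd c = e, (ArithmeticFunction.moebius (b / k) : ℤ) =
    ∑ k ∈ (b / e).divisors with k.gcd (c / e) = 1,
      (ArithmeticFunction.moebius (b / e / k) : ℤ) := by
  obtain ⟨c, rfl⟩ := hec
  obtain ⟨b, rfl⟩ := (dvd_mul_right e c).trans hcb
  rw [Nat.mul_div_cancel_left _ he, Nat.mul_div_cancel_left _ he]
  symm
  refine Finset.sum_bij (fun k _ => e * k) ?_ ?_ ?_ ?_
  · intro k hk
    simp only [Finset.mem_filter, Nat.mem_divisors] at hk ⊢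
    refine ⟨⟨mul_dvd_mul_left e hk.1.1, mul_ne_zero he.ne' hk.1.2⟩, ?_⟩
    rw [Nat.gcd_mul_left, hk.2, mul_one]
  · intro k _ k' _ h
    exact Nat.eq_of_mul_eq_mul_left he h
  · intro k hk
    simp only [Finset.mem_filter, Nat.mem_divisors] at hk
    obtain ⟨⟨h1, h2⟩, h3⟩ := hk
    obtain ⟨k, rfl⟩ : e ∣ k := by
      conv_lhs => rw [← h3]
      exact Nat.gcd_dvd_left _ _
    rw [Nat.gcd_mul_left] at h3
    refine ⟨k, ?_, rfl⟩
    simp only [Finset.mem_filter, Nat.mem_divisors]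
    exact ⟨⟨Nat.dvd_of_mul_dvd_mul_left he h1, right_ne_zero_of_mul h2⟩,
      Nat.eq_of_mul_eq_mul_left he (by rw [h3, mul_one])⟩
  · intro k _
    rw [Nat.mul_div_mul_left _ _ he]

open Classical in
/-- The entries of `N_d` as divisor sums. -/
theorem N_eq_sum_divisors (B₀ B₁ : CyclicSubgroup G) (d : ℕ) :
    N d B₀ B₁ = ((∑ k ∈ (Nat.card B₀.1).divisors with
      k.gcd (Nat.card ↥(B₀.1 ⊓ B₁.1)) * d = Nat.card B₁.1,
      (ArithmeticFunction.moebius (Nat.card B₀.1 / k) : ℤ) : ℤ) : ℝ) := by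
  have h := sum_subgroups_eq_sum_divisors B₀.2 (fun k =>
    if k.gcd (Nat.card ↥(B₀.1 ⊓ B₁.1)) * d = Nat.card B₁.1 then
      ((ArithmeticFunction.moebius (Nat.card B₀.1 / k) : ℤ) : ℝ) else 0)
  rw [Int.cast_sum, Finset.sum_filter, ← h, N, ← Finset.filter_filter, Finset.sum_filter]
  refine Finset.sum_congr rfl fun K hK => ?_
  have hK : K ≤ B₀.1 := (Finset.mem_filter.1 hK).2
  have h1 : Nat.card ↥(K ⊓ B₁.1) = (Nat.card K).gcd (Nat.card ↥(B₀.1 ⊓ B₁.1)) := by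
    rw [← card_inf_of_le B₀.2 hK inf_le_left, ← inf_assoc, inf_of_le_left hK]
  -- This is `|K ∩ B₁| · |K B₁ / K| = |B₁|`; it turns the index condition into a gcd condition on
  -- `|K|`.
  have h2 : (Nat.card K).gcd (Nat.card ↥(B₀.1 ⊓ B₁.1)) * K.relIndex (K ⊔ B₁.1) =
      Nat.card B₁.1 := by
    rw [Subgroup.relIndex_sup_left, ← h1, mul_comm, ← Subgroup.inf_relIndex_right,
      ← Subgroup.relIndex_bot_left, mul_comm,
      Subgroup.relIndex_mul_relIndex _ _ _ bot_le inf_le_right, Subgroup.relIndex_bot_left]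
  have h3 : K.relIndex B₀.1 = Nat.card B₀.1 / Nat.card K := by
    rw [← Subgroup.relIndex_bot_left, ← Subgroup.relIndex_bot_left,
      ← Subgroup.relIndex_mul_relIndex _ _ _ bot_le hK, Nat.mul_div_cancel_left]
    rw [Subgroup.relIndex_bot_left]; exact Nat.card_pos
  have h4 : 0 < (Nat.card K).gcd (Nat.card ↥(B₀.1 ⊓ B₁.1)) := Nat.gcd_pos_of_pos_left _ Nat.card_pos
  rw [h3]
  refine if_congr ?_ rfl rfl
  conv_rhs => rw [← h2]
  rw [Nat.mul_right_inj h4.ne', eq_comm]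

/-- The condition on `k` prescribes `gcd(k, |B₀ ∩ B₁|) = |B₁|/d`. Dividing out this gcd reduces to
the coprime case, where the Möbius sum is at most `1` in absolute value. -/
theorem abs_N_le_one (B₀ B₁ : CyclicSubgroup G) (d : ℕ) (hd : d ≠ 0) : |N d B₀ B₁| ≤ 1 := by
  rw [N_eq_sum_divisors]
  by_cases h : ∃ e, e * d = Nat.card B₁.1 ∧ e ∣ Nat.card ↥(B₀.1 ⊓ B₁.1)
  · obtain ⟨e, he, hec⟩ := h
    have he0 : 0 < e := Nat.pos_of_dvd_of_pos hec Nat.card_pos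
    have hcb := Subgroup.card_dvd_of_le (inf_le_left : B₀.1 ⊓ B₁.1 ≤ B₀.1)
    simp_rw [← he, Nat.mul_left_inj hd]
    rw [sum_gcd_eq_moebius he0 hec hcb]
    exact_mod_cast abs_sum_coprime_moebius_le
      (Nat.div_pos (Nat.le_of_dvd Nat.card_pos (hec.trans hcb)) he0).ne' _
  · rw [Finset.filter_false_of_mem]
    · simp
    · intro k _ hk
      exact h ⟨_, hk, Nat.gcd_dvd_right _ _⟩

/-- For `d = 1` the sum is over `B₁ ≤ K ≤ B₀`, and Möbius inversion leaves only `B₀ = B₁`. This lets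
the recursion be solved for its leading term. -/
theorem N_one : N (G := G) 1 = 1 := by
  ext B₀ B₁
  rw [N_eq_sum_divisors]
  simp_rw [mul_one]
  by_cases h : B₁.1 ≤ B₀.1
  · rw [inf_of_le_right h, sum_gcd_eq_moebius Nat.card_pos dvd_rfl (Subgroup.card_dvd_of_le h),
      Nat.div_self Nat.card_pos]
    simp only [Nat.gcd_one_right, Finset.filter_true]
    rw [sum_divisors_moebius, Matrix.one_apply]
    have : Nat.card B₀.1 / Nat.card B₁.1 = 1 ↔ B₀ = B₁ := by
      constructor
      · intro h1
        have h2 := Nat.div_mul_cancel (Subgroup.card_dvd_of_le h)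
        rw [h1, one_mul] at h2
        exact Subtype.ext (Subgroup.eq_of_le_of_card_ge h h2.ge).symm
      · rintro rfl
        exact Nat.div_self Nat.card_pos
    simp [this]
  · rw [Finset.filter_false_of_mem, Matrix.one_apply_ne]
    · simp
    · rintro rfl; exact h le_rfl
    · intro k _ hk
      apply h
      have h1 : Nat.card B₁.1 ∣ Nat.card ↥(B₀.1 ⊓ B₁.1) := by
        rw [← hk]; exact Nat.gcd_dvd_right _ _
      have h2 := Subgroup.eq_of_le_of_card_ge (inf_le_right : B₀.1 ⊓ B₁.1 ≤ B₁.1)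
        (Nat.le_of_dvd Nat.card_pos h1)
      exact h2 ▸ inf_le_left

end Cyclic

/-! ### Tails over the primes `p ≥ P` -/

section PrimeSums

theorem rpow_neg_mem_Ioc {p : ℕ} (hp : p.Prime) {σ : ℝ} (hσ : 1 < σ) :
    (p : ℝ) ^ (-σ) ∈ Set.Ioc (0 : ℝ) (1 / 2) := by
  have hp2 : (2 : ℝ) ≤ p := by exact_mod_cast hp.two_le
  refine ⟨by positivity, ?_⟩
  calc (p : ℝ) ^ (-σ) ≤ (p : ℝ) ^ (-1 : ℝ) :=
        Real.rpow_le_rpow_of_exponent_le (by linarith) (by linarith)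
    _ = (p : ℝ)⁻¹ := Real.rpow_neg_one _
    _ ≤ 1 / 2 := by rw [one_div]; gcongr

theorem zetaFactor_pos {p : ℕ} (hp : p.Prime) {σ : ℝ} (hσ : 1 < σ) : 0 < zetaFactor σ p := by
  have h := rpow_neg_mem_Ioc hp hσ
  exact inv_pos.2 (by linarith [h.2])

theorem log_zetaFactor_nonneg {p : ℕ} (hp : p.Prime) {σ : ℝ} (hσ : 1 < σ) :
    0 ≤ Real.log (zetaFactor σ p) := by
  have h := rpow_neg_mem_Ioc hp hσ
  exact Real.log_nonneg ((one_le_inv₀ (by linarith [h.2])).2 (by linarith [h.1]))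

/-- A tail of the series `∑ n^{-σ}`, compared with an integral. -/
theorem sum_range_rpow_neg_le {N₀ : ℕ} (hN : 0 < N₀) {σ : ℝ} (hσ : 1 < σ) (n : ℕ) :
    ∑ j ∈ Finset.range n, ((N₀ + j : ℕ) : ℝ) ^ (-σ) ≤
      (N₀ : ℝ) ^ (-σ) + (N₀ : ℝ) ^ (1 - σ) / (σ - 1) := by
  have hN' : (0 : ℝ) < N₀ := by exact_mod_cast hN
  have hpos : 0 ≤ (N₀ : ℝ) ^ (1 - σ) / (σ - 1) := div_nonneg (by positivity) (by linarith)
  rcases n with _ | n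
  · simp only [Finset.range_zero, Finset.sum_empty]; positivity
  rw [Finset.sum_range_succ']
  have h1 : AntitoneOn (fun x : ℝ => x ^ (-σ)) (Set.Icc (N₀ : ℝ) (N₀ + n)) := by
    intro x hx y hy hxy
    exact Real.rpow_le_rpow_of_nonpos (by linarith [hx.1]) hxy (by linarith)
  have h2 := h1.sum_le_integral
  rw [integral_rpow (Or.inr ⟨by linarith, by
    rw [Set.uIcc_of_le (by simp)]; intro h; linarith [h.1]⟩)] at h2
  have h3 : 0 ≤ ((N₀ : ℝ) + n) ^ (1 - σ) / (σ - 1) := div_nonneg (by positivity) (by linarith)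
  have h4 : (((N₀ : ℝ) + n) ^ (-σ + 1) - (N₀ : ℝ) ^ (-σ + 1)) / (-σ + 1) =
      (N₀ : ℝ) ^ (1 - σ) / (σ - 1) - ((N₀ : ℝ) + n) ^ (1 - σ) / (σ - 1) := by
    rw [show -σ + 1 = 1 - σ by ring, show σ - 1 = -(1 - σ) by ring]
    have : 1 - σ ≠ 0 := by linarith
    field_simp
    ring
  rw [h4] at h2
  push_cast at h2 ⊢
  simp only [add_zero]
  linarith

/-- The bound `(1 + P / (σ - 1)) / P ^ σ` for the primes `p ≥ P`. -/
theorem summable_log_zetaFactor_and_tsum_le {P : ℝ} (hP : 2 ≤ P) {σ : ℝ} (hσ : 1 < σ) :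
    Summable (fun p : PrimeGE P => Real.log (zetaFactor σ p.1)) ∧
    ∑' p : PrimeGE P, Real.log (zetaFactor σ p.1) ≤ (1 + P / (σ - 1)) / P ^ σ := by
  set N₀ := ⌈P⌉₊ with hN₀
  have hPN : P ≤ N₀ := Nat.le_ceil P
  have hN : 0 < N₀ := Nat.ceil_pos.2 (by linarith)
  have hsum := summable_of_sum_range_le (fun j => by positivity)
    (sum_range_rpow_neg_le hN hσ)
  have htsum := Real.tsum_le_of_sum_range_le (fun j => by positivity)
    (sum_range_rpow_neg_le hN hσ)
  have hle : ∀ x : PrimeGE P × ℕ, N₀ ≤ x.1.1 ^ (x.2 + 1) := by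
    intro x
    rw [hN₀, Nat.ceil_le]
    exact x.1.2.2.trans (by exact_mod_cast Nat.le_self_pow (Nat.succ_ne_zero _) _)
  -- The powers `p^(k+1)` are distinct integers `≥ N₀`, so the double sum over `p` and `k` is a
  -- subsum of the tail of `∑ n^{-σ}`.
  let i : PrimeGE P × ℕ → ℕ := fun x => x.1.1 ^ (x.2 + 1) - N₀
  have hi : Function.Injective i := by
    intro x y h
    have h1 : x.1.1 ^ (x.2 + 1) = y.1.1 ^ (y.2 + 1) := by
      have := hle x; have := hle y; simp only [i] at h; omega
    have h2 : ((⟨x.1.1, x.1.2.1⟩, x.2) : Nat.Primes × ℕ) = (⟨y.1.1, y.1.2.1⟩, y.2) :=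
      Nat.Primes.prodNatEquiv.injective (Subtype.ext h1)
    have h3 := Prod.mk.inj h2
    exact Prod.ext (Subtype.ext (Subtype.mk.inj h3.1)) h3.2
  have hterm : ∀ x : PrimeGE P × ℕ, ((N₀ + i x : ℕ) : ℝ) ^ (-σ) =
      ((x.1.1 : ℝ) ^ (-σ)) ^ (x.2 + 1) := by
    intro x
    rw [show N₀ + i x = x.1.1 ^ (x.2 + 1) from Nat.add_sub_cancel' (hle x), Nat.cast_pow,
      ← Real.rpow_natCast, ← Real.rpow_natCast, ← Real.rpow_mul (by positivity),
      ← Real.rpow_mul (by positivity), mul_comm]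
  have hs2 : Summable fun x : PrimeGE P × ℕ => ((x.1.1 : ℝ) ^ (-σ)) ^ (x.2 + 1) :=
    (hsum.comp_injective hi).congr hterm
  have hs3 := hs2.prod
  have ht2 : ∑' x : PrimeGE P × ℕ, ((x.1.1 : ℝ) ^ (-σ)) ^ (x.2 + 1) ≤
      (N₀ : ℝ) ^ (-σ) + (N₀ : ℝ) ^ (1 - σ) / (σ - 1) := by
    refine le_trans (hs2.tsum_le_tsum_of_inj i hi (fun _ _ => by positivity)
      (fun x => (hterm x).ge) hsum) htsum
  rw [hs2.tsum_prod] at ht2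
  -- From `log y ≤ y - 1` at `y = (1 - x)⁻¹`, expanded as a geometric series.
  have hlog : ∀ p : PrimeGE P, Real.log (zetaFactor σ p.1) ≤
      ∑' k : ℕ, ((p.1 : ℝ) ^ (-σ)) ^ (k + 1) := by
    intro p
    have h := rpow_neg_mem_Ioc p.2.1 hσ
    set x := (p.1 : ℝ) ^ (-σ)
    have hx : 0 < 1 - x := by linarith [h.2]
    have h5 : ∑' k : ℕ, x ^ (k + 1) = (1 - x)⁻¹ - 1 := by
      simp_rw [pow_succ]
      rw [tsum_mul_right, tsum_geometric_of_lt_one h.1.le (by linarith [h.2])]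
      field_simp
      ring
    rw [h5]
    exact Real.log_le_sub_one_of_pos (inv_pos.2 hx)
  have hs4 : Summable (fun p : PrimeGE P => Real.log (zetaFactor σ p.1)) :=
    Summable.of_nonneg_of_le (fun p => log_zetaFactor_nonneg p.2.1 hσ) hlog hs3
  refine ⟨hs4, (hs4.tsum_le_tsum hlog hs3).trans (ht2.trans ?_)⟩
  have hP0 : 0 < P := by linarith
  have h6 : (1 + P / (σ - 1)) / P ^ σ = P ^ (-σ) + P ^ (1 - σ) / (σ - 1) := by
    rw [Real.rpow_sub hP0, Real.rpow_neg hP0.le, Real.rpow_one]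
    have := (Real.rpow_pos_of_pos hP0 σ).ne'
    have : σ - 1 ≠ 0 := by linarith
    field_simp
  rw [h6]
  exact add_le_add (Real.rpow_le_rpow_of_nonpos hP0 hPN (by linarith))
    (div_le_div_of_nonneg_right (Real.rpow_le_rpow_of_nonpos hP0 hPN (by linarith))
      (by linarith))

theorem summable_log_zetaFactor {P : ℝ} (hP : 2 ≤ P) {σ : ℝ} (hσ : 1 < σ) :
    Summable (fun p : PrimeGE P => Real.log (zetaFactor σ p.1)) :=
  (summable_log_zetaFactor_and_tsum_le hP hσ).1

theorem summable_rpow_neg_primeGE (P : ℝ) {σ : ℝ} (hσ : 1 < σ) :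
    Summable (fun p : PrimeGE P => (p.1 : ℝ) ^ (-σ)) :=
  (Real.summable_nat_rpow.2 (by linarith)).comp_injective Subtype.val_injective

end PrimeSums

/-! ### Lattice-invariant classes and the vector `V_s` -/

section Classes

variable {q : ℕ}

/-- The class of a unit: the generators of the cyclic subgroup it generates. -/
def classOf {G : Type} [CommGroup G] (u : G) : LatticeClass G :=
  ⟨{x | Subgroup.zpowers x = Subgroup.zpowers u}, Subgroup.zpowers u, inferInstance, rfl⟩

theorem mem_iff_eq_classOf {G : Type} [CommGroup G] (u : G) (A : LatticeClass G) :
    u ∈ A.1 ↔ A = classOf u := by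
  obtain ⟨_, K, hK, rfl⟩ := A
  constructor
  · intro h
    refine Subtype.ext ?_
    change {x : G | Subgroup.zpowers x = K} = {x : G | Subgroup.zpowers x = Subgroup.zpowers u}
    rw [show Subgroup.zpowers u = K from h]
  · intro h
    rw [h]
    exact rfl

theorem closure_eq_zpowers {G : Type} [CommGroup G] {u : G} {A : LatticeClass G} (h : u ∈ A.1) :
    Subgroup.closure A.1 = Subgroup.zpowers u := by
  rw [mem_iff_eq_classOf] at h
  rw [h]
  exact closure_generators _ inferInstance

/-- The prime `p` lies in the class `A` modulo `q`. -/
abbrev InClass (A : LatticeClass (ZMod q)ˣ) (p : ℕ) : Prop :=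
  ∃ a ∈ A.1, (a : ZMod q) = (p : ZMod q)

variable [NeZero q]

open Classical in
theorem sum_inClass_le (p : ℕ) {c : ℝ} (hc : 0 ≤ c) :
    ∑ A : LatticeClass (ZMod q)ˣ, (if InClass A p then c else 0) ≤ c := by
  by_cases h : ∃ u : (ZMod q)ˣ, (u : ZMod q) = p
  · obtain ⟨u, hu⟩ := h
    have : ∀ A : LatticeClass (ZMod q)ˣ, InClass A p ↔ A = classOf u := by
      intro A
      rw [← mem_iff_eq_classOf]
      exact ⟨fun ⟨a, ha, h⟩ => Units.ext (h.trans hu.symm) ▸ ha, fun h => ⟨u, h, hu⟩⟩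
    simp [this]
  · have : ∀ A : LatticeClass (ZMod q)ˣ, ¬ InClass A p := fun A ⟨a, _, ha⟩ => h ⟨a, ha⟩
    simpa [this] using hc

/-- Forgetting the residue class. -/
def PrimeGEIn.toPrimeGE {P : ℝ} {q : ℕ} {A : Set (ZMod q)ˣ} (p : PrimeGEIn P q A) : PrimeGE P :=
  ⟨p.1, p.2.1, p.2.2.1⟩

theorem PrimeGEIn.toPrimeGE_injective {P : ℝ} {q : ℕ} {A : Set (ZMod q)ˣ} :
    Function.Injective (PrimeGEIn.toPrimeGE (P := P) (q := q) (A := A)) := fun _ _ h =>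
  Subtype.ext (congrArg (fun z : PrimeGE P => z.1) h)

theorem summable_log_zetaFactor_primeGEIn {q : ℕ} (A : Set (ZMod q)ˣ) {P : ℝ} (hP : 2 ≤ P) {σ : ℝ}
    (hσ : 1 < σ) : Summable fun p : PrimeGEIn P q A => Real.log (zetaFactor σ p.1) := by
  have h := (summable_log_zetaFactor hP hσ).comp_injective (PrimeGEIn.toPrimeGE_injective (A := A))
  exact h

theorem multipliable_zetaFactor {q : ℕ} (A : Set (ZMod q)ˣ) {P : ℝ} (hP : 2 ≤ P)
    {σ : ℝ} (hσ : 1 < σ) :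
    Multipliable fun p : PrimeGEIn P q A => zetaFactor σ p.1 := by
  refine Real.multipliable_of_summable_log (fun p => zetaFactor_pos p.2.1 hσ) ?_
  exact summable_log_zetaFactor_primeGEIn A hP hσ

open Classical in
-- All coordinates are put over the same index set of primes, so that they can be added prime by
-- prime.
theorem hasSum_VVec (A : LatticeClass (ZMod q)ˣ) {P : ℝ} (hP : 2 ≤ P) {σ : ℝ} (hσ : 1 < σ) :
    HasSum (fun p : PrimeGE P => if InClass A p.1 then Real.log (zetaFactor σ p.1) else 0)
      (VVec q P σ A) := by
  have hs := summable_log_zetaFactor_primeGEIn A.1 hP hσ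
  have h1 : VVec q P σ A = ∑' p : PrimeGEIn P q A.1, Real.log (zetaFactor σ p.1) := by
    rw [VVec, zetaP, ← Real.rexp_tsum_eq_tprod (fun p => zetaFactor_pos p.2.1 hσ) hs, Real.log_exp]
  rw [h1, ← PrimeGEIn.toPrimeGE_injective.hasSum_iff]
  · refine Eq.mpr (congrArg (HasSum · _) (funext fun p => ?_)) hs.hasSum
    exact if_pos p.2.2.2
  · intro p hp
    refine if_neg fun h => hp ⟨⟨p.1, p.2.1, p.2.2, h⟩, rfl⟩

theorem VVec_nonneg (A : LatticeClass (ZMod q)ˣ) {P : ℝ} (hP : 2 ≤ P) {σ : ℝ} (hσ : 1 < σ) :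
    0 ≤ VVec q P σ A := by
  classical
  refine (hasSum_VVec A hP hσ).nonneg fun p => ?_
  split_ifs
  exacts [log_zetaFactor_nonneg p.2.1 hσ, le_rfl]

/-- Each prime lies in at most one class, so the `ℓ¹` norm of the vector costs one prime tail
instead of `|G^♯|` of them. -/
theorem sum_VVec_le {P : ℝ} (hP : 2 ≤ P) {σ : ℝ} (hσ : 1 < σ) :
    ∑ A, VVec q P σ A ≤ (1 + P / (σ - 1)) / P ^ σ := by
  classical
  have h : HasSum (fun p : PrimeGE P => ∑ A : LatticeClass (ZMod q)ˣ,
      if InClass A p.1 then Real.log (zetaFactor σ p.1) else 0) (∑ A, VVec q P σ A) :=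
    hasSum_sum fun A _ => hasSum_VVec A hP hσ
  obtain ⟨h1, h2⟩ := summable_log_zetaFactor_and_tsum_le hP hσ
  refine le_trans ?_ h2
  refine hasSum_le (fun p => ?_) h h1.hasSum
  exact sum_inClass_le p.1 (log_zetaFactor_nonneg p.2.1 hσ)

end Classes

/-! ### Products of `L_P(ts, χ)` in terms of the `ζ_P` -/

section LProducts

theorem LFactor_ofReal {q : ℕ} (χ : DirichletCharacter ℂ q) (σ : ℝ) {p : ℕ} :
    LFactor χ (σ : ℂ) p = (1 - χ (p : ZMod q) * (((p : ℝ) ^ (-σ) : ℝ) : ℂ))⁻¹ := by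
  rw [LFactor, div_eq_mul_inv, Complex.ofReal_cpow (Nat.cast_nonneg p), Complex.ofReal_neg,
    Complex.cpow_neg, Complex.ofReal_natCast]

theorem multipliable_LFactor {q : ℕ} (χ : DirichletCharacter ℂ q) (P : ℝ) {σ : ℝ} (hσ : 1 < σ) :
    Multipliable fun p : PrimeGE P => LFactor χ (σ : ℂ) p.1 := by
  have h : Summable fun p : PrimeGE P => ‖LFactor χ (σ : ℂ) p.1 - 1‖ := by
    refine Summable.of_nonneg_of_le (fun _ => norm_nonneg _) (fun p => ?_)
      ((summable_rpow_neg_primeGE P hσ).mul_left 2)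
    have h := rpow_neg_mem_Ioc p.2.1 hσ
    rw [LFactor_ofReal]
    set x := (p.1 : ℝ) ^ (-σ)
    set z := χ (p.1 : ZMod q) * (x : ℂ) with hz
    have hzx : ‖z‖ ≤ x := by
      rw [hz, norm_mul, Complex.norm_real, Real.norm_of_nonneg h.1.le]
      exact mul_le_of_le_one_left h.1.le (χ.norm_le_one _)
    have h1 : 1 / 2 ≤ ‖1 - z‖ := by
      have := norm_sub_norm_le (1 : ℂ) z
      rw [norm_one] at this
      linarith [h.2]
    have h2 : 1 - z ≠ 0 := by
      intro h0; rw [h0, norm_zero] at h1; linarith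
    rw [show (1 - z)⁻¹ - 1 = z / (1 - z) by field_simp; ring, norm_div,
      div_le_iff₀ (by linarith)]
    nlinarith [h.1]
  refine (multipliable_one_add_of_summable h).congr fun p => ?_
  ring

variable {q : ℕ} [NeZero q]

open Classical in
/-- The coefficient-weighted local logarithm of `∏_{χ ∈ G₀^⊥} L(σ, χ)` at `p`. -/
def localLog (G₀ : Subgroup (ZMod q)ˣ) (σ : ℝ) (p : ℕ) : ℝ :=
  ∑ A : LatticeClass (ZMod q)ˣ,
    (G₀.index : ℝ) / (G₀.relIndex (G₀ ⊔ Subgroup.closure A.1) : ℝ) *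
      if InClass A p then
        Real.log (zetaFactor (G₀.relIndex (G₀ ⊔ Subgroup.closure A.1) * σ) p) else 0

theorem relIndex_pos {G : Type} [CommGroup G] [Finite G] (H K : Subgroup G) : 0 < H.relIndex K :=
  Nat.pos_of_ne_zero Subgroup.index_ne_zero_of_finite

theorem one_lt_natCast_mul {n : ℕ} (hn : 0 < n) {σ : ℝ} (hσ : 1 < σ) : 1 < n * σ := by
  have : (1 : ℝ) ≤ n := by exact_mod_cast hn
  nlinarith

theorem prod_perp_LFactor (G₀ : Subgroup (ZMod q)ˣ) {σ : ℝ} (hσ : 1 < σ) {p : ℕ} (hp : p.Prime) :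
    ∏ χ ∈ perp G₀, LFactor χ (σ : ℂ) p = ((Real.exp (localLog G₀ σ p) : ℝ) : ℂ) := by
  classical
  simp_rw [LFactor_ofReal, Finset.prod_inv_distrib]
  by_cases h : ∃ u : (ZMod q)ˣ, (u : ZMod q) = p
  · obtain ⟨u, hu⟩ := h
    have h0 : ∀ A : LatticeClass (ZMod q)ˣ, InClass A p ↔ A = classOf u := by
      intro A
      rw [← mem_iff_eq_classOf]
      exact ⟨fun ⟨a, ha, h⟩ => Units.ext (h.trans hu.symm) ▸ ha, fun h => ⟨u, h, hu⟩⟩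
    have h1 : Subgroup.closure (classOf u).1 = Subgroup.zpowers u :=
      closure_eq_zpowers ((mem_iff_eq_classOf u _).2 rfl)
    have h2 : localLog G₀ σ p = (G₀.index : ℝ) / (G₀.relIndex (G₀ ⊔ Subgroup.zpowers u) : ℝ) *
        Real.log (zetaFactor (G₀.relIndex (G₀ ⊔ Subgroup.zpowers u) * σ) p) := by
      simp_rw [localLog, h0, mul_ite, mul_zero]
      rw [Finset.sum_ite_eq' Finset.univ (classOf u), if_pos (Finset.mem_univ _), h1]
    obtain ⟨m, hm, hprod⟩ := prod_perp_one_sub G₀ u (((p : ℝ) ^ (-σ) : ℝ) : ℂ)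
    have hf := relIndex_pos G₀ (G₀ ⊔ Subgroup.zpowers u)
    set f := G₀.relIndex (G₀ ⊔ Subgroup.zpowers u)
    have hf' : (f : ℝ) ≠ 0 := by exact_mod_cast hf.ne'
    have h3 : (G₀.index : ℝ) / f = m := by
      rw [← hm, Nat.cast_mul, mul_div_cancel_right₀ _ hf']
    have h4 : ((p : ℝ) ^ (-σ)) ^ f = (p : ℝ) ^ (-(f * σ)) := by
      rw [← Real.rpow_natCast, ← Real.rpow_mul (by positivity)]
      ring_nf
    rw [← hu, hprod, h2, h3, Real.exp_nat_mul,
      Real.exp_log (zetaFactor_pos hp (one_lt_natCast_mul hf hσ)), zetaFactor, ← h4]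
    push_cast
    rw [inv_pow]
  -- If `p` divides `q`, it lies in no class and all characters vanish at `p`: both sides are `1`.
  · have h0 : ∀ A : LatticeClass (ZMod q)ˣ, ¬ InClass A p := fun A ⟨a, _, ha⟩ => h ⟨a, ha⟩
    have h1 : ∀ χ : DirichletCharacter ℂ q, χ (p : ZMod q) = 0 := fun χ =>
      χ.map_nonunit fun ⟨u, hu⟩ => h ⟨u, hu⟩
    simp [localLog, h0, h1]

theorem hasSum_localLog (G₀ : Subgroup (ZMod q)ˣ) {P : ℝ} (hP : 2 ≤ P) {σ : ℝ} (hσ : 1 < σ) :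
    HasSum (fun p : PrimeGE P => localLog G₀ σ p.1)
      (∑ A : LatticeClass (ZMod q)ˣ,
        (G₀.index : ℝ) / (G₀.relIndex (G₀ ⊔ Subgroup.closure A.1) : ℝ) *
          VVec q P (G₀.relIndex (G₀ ⊔ Subgroup.closure A.1) * σ) A) := by
  classical
  exact hasSum_sum fun A _ =>
    (hasSum_VVec A hP (one_lt_natCast_mul (relIndex_pos _ _) hσ)).mul_left _

/-- The product of the `L_P(ts, χ)` over `G₀^⊥` is the exponential of a combination of the
logarithms of the `ζ_P(fts; q, A)`. -/
theorem LProd_eq_exp (G₀ : Subgroup (ZMod q)ˣ) {P : ℝ} (hP : 2 ≤ P) {s : ℝ} (hs : 1 < s) {t : ℕ}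
    (ht : 0 < t) :
    LProd P s G₀ t = ((Real.exp (∑ A : LatticeClass (ZMod q)ˣ,
        (G₀.index : ℝ) / (G₀.relIndex (G₀ ⊔ Subgroup.closure A.1) : ℝ) *
          VVec q P (G₀.relIndex (G₀ ⊔ Subgroup.closure A.1) * (t * s)) A) : ℝ) : ℂ) := by
  have hσ := one_lt_natCast_mul ht hs
  simp_rw [LProd, LP]
  rw [← Multipliable.tprod_finsetProd fun χ _ => multipliable_LFactor χ P hσ]
  simp_rw [fun p : PrimeGE P => prod_perp_LFactor G₀ hσ p.2.1]
  exact ((hasSum_localLog G₀ hP hσ).rexp.map Complex.ofRealHom Complex.continuous_ofReal).tprod_eq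

theorem gammaS_eq (G₀ : Subgroup (ZMod q)ˣ) {P : ℝ} (hP : 2 ≤ P) {s : ℝ} (hs : 1 < s) {t : ℕ}
    (ht : 0 < t) :
    gammaS P s G₀ t = ∑ A : LatticeClass (ZMod q)ˣ,
        (G₀.index : ℝ) / (G₀.relIndex (G₀ ⊔ Subgroup.closure A.1) : ℝ) *
          VVec q P (G₀.relIndex (G₀ ⊔ Subgroup.closure A.1) * (t * s)) A := by
  rw [gammaS, LProd_eq_exp G₀ hP hs ht, Complex.ofReal_re, Real.log_exp]

end LProducts

/-! ### Möbius inversion and the recursion for `V_s` -/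

section Recursion

variable {q : ℕ} [NeZero q]

open Classical in
-- Subgroups of a cyclic group are cyclic; this reconciles `M1Inv`, indexed by cyclic subgroups,
-- with `N`, which sums over all subgroups.
theorem sum_cyclicSubgroup_eq {G : Type} [CommGroup G] [Finite G] {B : Subgroup G} (hB : IsCyclic B)
    (f : Subgroup G → ℝ) :
    ∑ K : CyclicSubgroup G, (if K.1 ≤ B then f K.1 else 0) = ∑ K : Subgroup G with K ≤ B, f K := by
  rw [← Finset.sum_filter]
  refine Finset.sum_bij (fun K _ => K.1) ?_ ?_ ?_ ?_
  · intro K hK; simpa using hK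
  · intro K _ K' _ h; exact Subtype.ext h
  · intro K hK
    have hK' : K ≤ B := (Finset.mem_filter.1 hK).2
    exact ⟨⟨K, Subgroup.isCyclic_of_le hK'⟩, by simpa using hK', rfl⟩
  · intros; rfl

theorem isCyclic_closure {G : Type} [CommGroup G] (A : LatticeClass G) :
    IsCyclic (Subgroup.closure A.1) := (classEquiv A).2

theorem relIndex_sup_closure_mem_divisors {G : Type} [CommGroup G] [Finite G] (K : Subgroup G)
    (A : LatticeClass G) :
    K.relIndex (K ⊔ Subgroup.closure A.1) ∈ (Monoid.exponent G).divisors := by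
  have := isCyclic_closure A
  rw [Nat.mem_divisors, Subgroup.relIndex_sup_left]
  refine ⟨(Subgroup.relIndex_dvd_card _ _).trans ?_, Monoid.exponent_ne_zero_of_finite⟩
  rw [← IsCyclic.exponent_eq_card]
  exact Monoid.exponent_submonoid_dvd (Subgroup.closure A.1).toSubmonoid

/-- Inversion of `M₁`: the vector `M₁⁻¹ Γ_s(t)` is the sum of the `(N_d / d) V_s(d t)`. -/
theorem M1Inv_mulVec_GammaVec {P : ℝ} (hP : 2 ≤ P) {s : ℝ} (hs : 1 < s) {t : ℕ} (ht : 0 < t) :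
    M1Inv.mulVec (GammaVec q P s t) = ∑ d ∈ (Monoid.exponent (ZMod q)ˣ).divisors,
      ((d : ℝ)⁻¹ • NClass (G := (ZMod q)ˣ) d).mulVec (VVec q P (d * (t * s))) := by
  classical
  funext A
  have h1 : M1Inv.mulVec (GammaVec q P s t) A =
      ∑ K : CyclicSubgroup (ZMod q)ˣ, if K.1 ≤ Subgroup.closure A.1 then
        ((ArithmeticFunction.moebius (K.1.relIndex (Subgroup.closure A.1)) : ℤ) : ℝ) / K.1.index *
          gammaS P s K.1 t else 0 := by
    refine Finset.sum_congr rfl fun K _ => ?_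
    simp only [M1Inv, GammaVec, ite_mul, zero_mul]
  rw [h1, sum_cyclicSubgroup_eq (isCyclic_closure A) fun K =>
    ((ArithmeticFunction.moebius (K.relIndex (Subgroup.closure A.1)) : ℤ) : ℝ) / K.index *
          gammaS P s K t, Finset.sum_apply]
  have h2 : ∀ d : ℕ, ((d : ℝ)⁻¹ • NClass (G := (ZMod q)ˣ) d).mulVec (VVec q P (d * (t * s))) A =
      ∑ K : Subgroup (ZMod q)ˣ with K ≤ Subgroup.closure A.1, ∑ B : LatticeClass (ZMod q)ˣ,
        if K.relIndex (K ⊔ Subgroup.closure B.1) = d then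
          (d : ℝ)⁻¹ * ((ArithmeticFunction.moebius (K.relIndex (Subgroup.closure A.1)) : ℤ) : ℝ) *
            VVec q P (d * (t * s)) B else 0 := by
    intro d
    rw [Finset.sum_comm]
    refine Finset.sum_congr rfl fun B _ => ?_
    have h3 : NClass (G := (ZMod q)ˣ) d A B = N d (classEquiv A) (classEquiv B) := rfl
    change (d : ℝ)⁻¹ * NClass (G := (ZMod q)ˣ) d A B * _ = _
    rw [h3, N, ← Finset.filter_filter, Finset.sum_filter,
      Finset.mul_sum, Finset.sum_mul]
    refine Finset.sum_congr rfl fun K _ => ?_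
    rw [mul_ite, mul_zero, ite_mul, zero_mul]
    rfl
  simp_rw [h2]
  rw [Finset.sum_comm]
  refine Finset.sum_congr rfl fun K _ => ?_
  rw [Finset.sum_comm, gammaS_eq K hP hs ht, Finset.mul_sum]
  refine Finset.sum_congr rfl fun B _ => ?_
  -- For given `K` and `B` exactly one `d` contributes, namely `|K⟨B⟩/K|`, which divides `exp G`.
  rw [Finset.sum_ite_eq, if_pos (relIndex_sup_closure_mem_divisors K B)]
  have hi : (K.index : ℝ) ≠ 0 := by exact_mod_cast Subgroup.index_ne_zero_of_finite
  field_simp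

theorem NClass_one {G : Type} [CommGroup G] [Finite G] : NClass (G := G) 1 = 1 := by
  rw [NClass, N_one, Matrix.reindex_apply, Matrix.submatrix_one_equiv]

theorem VVec_recursion {P : ℝ} (hP : 2 ≤ P) {s : ℝ} (hs : 1 < s) {t : ℕ} (ht : 0 < t) :
    M1Inv.mulVec (GammaVec q P s t) = VVec q P (t * s) +
      ∑ d ∈ (Monoid.exponent (ZMod q)ˣ).divisors.erase 1,
        ((d : ℝ)⁻¹ • NClass (G := (ZMod q)ˣ) d).mulVec (VVec q P ((t * d : ℕ) * s)) := by
  rw [M1Inv_mulVec_GammaVec hP hs ht, ← Finset.add_sum_erase _ _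
    (Nat.one_mem_divisors.2 Monoid.exponent_ne_zero_of_finite), NClass_one]
  congr 1
  · simp
  · refine Finset.sum_congr rfl fun d _ => ?_
    rw [Nat.cast_mul, mul_right_comm, mul_comm, mul_assoc, mul_comm s]

end Recursion

/-! ### Iterating the recursion over tuples of divisors -/

section Truncation

variable {q : ℕ}

/-- The product `(N_{d₁} / d₁) ⋯ (N_{d_v} / d_v)`. -/
def NProd (q : ℕ) [NeZero q] {v : ℕ} (d : Fin v → ℕ) :
    Matrix (LatticeClass (ZMod q)ˣ) (LatticeClass (ZMod q)ˣ) ℝ :=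
  (List.ofFn fun i : Fin v => ((d i : ℝ)⁻¹) • NClass (G := (ZMod q)ˣ) (d i)).prod

theorem prod_snoc' {v : ℕ} (d : Fin v → ℕ) (e : ℕ) :
    ∏ i, (Fin.snoc d e : Fin (v + 1) → ℕ) i = (∏ i, d i) * e := by
  simp [Fin.prod_univ_castSucc]

/-- The divisors of the exponent other than `1`. -/
abbrev properDivs (q : ℕ) : Finset ℕ := (Monoid.exponent (ZMod q)ˣ).divisors.erase 1

theorem two_le_of_mem_properDivs {e : ℕ} (he : e ∈ properDivs q) : 2 ≤ e := by
  rw [Finset.mem_erase] at he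
  have := Nat.pos_of_mem_divisors he.2
  omega

theorem mem_divisorTuples {v z : ℕ} {d : Fin v → ℕ} :
    d ∈ divisorTuples q v z ↔ (∀ i, d i ∈ properDivs q) ∧ ∏ i, d i ≤ z := by
  simp only [divisorTuples, Finset.mem_filter, Fintype.mem_piFinset]

theorem NProd_snoc [NeZero q] {v : ℕ} (d : Fin v → ℕ) (e : ℕ) :
    NProd q (Fin.snoc d e : Fin (v + 1) → ℕ) =
      NProd q d * ((e : ℝ)⁻¹ • NClass (G := (ZMod q)ˣ) e) := by
  rw [NProd, List.ofFn_succ', List.concat_eq_append, List.prod_append]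
  simp [NProd]

theorem two_pow_le_prod {v : ℕ} {d : Fin v → ℕ} (hd : ∀ i, d i ∈ properDivs q) :
    2 ^ v ≤ ∏ i, d i := by
  calc 2 ^ v = ∏ _i : Fin v, 2 := by simp
    _ ≤ _ := Finset.prod_le_prod' fun i _ => two_le_of_mem_properDivs (hd i)

/-- A prefix of an admissible tuple is admissible, because the removed last entry is at least `1`.
-/
theorem sum_divisorTuples_succ {E : Type*} [AddCommMonoid E] {v z : ℕ}
    (F : (Fin (v + 1) → ℕ) → E) :
    ∑ d ∈ divisorTuples q (v + 1) z, F d = ∑ d ∈ divisorTuples q v z,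
      ∑ e ∈ properDivs q with (∏ i, d i) * e ≤ z, F (Fin.snoc d e) := by
  rw [Finset.sum_sigma']
  symm
  refine Finset.sum_bij (fun x _ => Fin.snoc x.1 x.2) ?_ ?_ ?_ ?_
  · rintro ⟨d, e⟩ h
    simp only [Finset.mem_sigma, mem_divisorTuples, Finset.mem_filter] at h
    rw [mem_divisorTuples, prod_snoc']
    refine ⟨fun i => ?_, h.2.2⟩
    refine Fin.lastCases ?_ (fun j => ?_) i
    · simpa using h.2.1
    · simpa using h.1.1 j
  · rintro ⟨d, e⟩ _ ⟨d', e'⟩ _ h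
    obtain ⟨rfl, rfl⟩ := Fin.snoc_injective2 h
    rfl
  · intro d hd
    rw [mem_divisorTuples, Fin.prod_univ_castSucc] at hd
    refine ⟨⟨fun i => d i.castSucc, d (Fin.last v)⟩, ?_, Fin.snoc_init_self d⟩
    simp only [Finset.mem_sigma, mem_divisorTuples, Finset.mem_filter]
    refine ⟨⟨fun i => hd.1 _, le_trans (Nat.le_mul_of_pos_right _ ?_) hd.2⟩, hd.1 _, hd.2⟩
    exact two_pos.trans_le (two_le_of_mem_properDivs (hd.1 _))
  · intros; rfl

variable [NeZero q]

/-- The vector attached to a tuple. -/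
def tupleVec (q : ℕ) [NeZero q] (P s : ℝ) {v : ℕ} (d : Fin v → ℕ) : LatticeClass (ZMod q)ˣ → ℝ :=
  (NProd q d).mulVec (VVec q P ((∏ i, d i : ℕ) * s))

theorem tuple_recursion {P : ℝ} (hP : 2 ≤ P) {s : ℝ} (hs : 1 < s) {v : ℕ} {d : Fin v → ℕ}
    (hd : ∀ i, d i ∈ properDivs q) :
    (NProd q d).mulVec (M1Inv.mulVec (GammaVec q P s (∏ i, d i))) = tupleVec q P s d +
      ∑ e ∈ properDivs q, tupleVec q P s (Fin.snoc d e : Fin (v + 1) → ℕ) := by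
  have ht : 0 < ∏ i, d i := (pow_pos two_pos v).trans_le (two_pow_le_prod hd)
  rw [VVec_recursion hP hs ht, Matrix.mulVec_add, Matrix.mulVec_sum]
  simp only [tupleVec, NProd_snoc, prod_snoc', Matrix.mulVec_mulVec]

/-- Truncated iteration of the recursion: the exact remainder. -/
theorem VVec_sub_approx {P : ℝ} (hP : 2 ≤ P) {s : ℝ} (hs : 1 < s) (k r : ℕ) :
    VVec q P s - (∑ v ∈ Finset.range k, (-1 : ℝ) ^ v • ∑ d ∈ divisorTuples q v (2 ^ r),
        (NProd q d).mulVec (M1Inv.mulVec (GammaVec q P s (∏ i, d i)))) =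
      (-1 : ℝ) ^ k • ∑ d ∈ divisorTuples q k (2 ^ r), tupleVec q P s d -
      ∑ v ∈ Finset.range k, (-1 : ℝ) ^ v • ∑ d ∈ divisorTuples q v (2 ^ r),
        ∑ e ∈ properDivs q with ¬ (∏ i, d i) * e ≤ 2 ^ r,
          tupleVec q P s (Fin.snoc d e : Fin (v + 1) → ℕ) := by
  induction k with
  | zero =>
    have h0 : divisorTuples q 0 (2 ^ r) = {Fin.elim0} := by
      ext d
      simp [mem_divisorTuples, Subsingleton.elim d Fin.elim0, Nat.one_le_two_pow]
    simp [h0, tupleVec, NProd]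
  | succ k ih =>
    rw [Finset.sum_range_succ, Finset.sum_range_succ, ← sub_sub, ih]
    -- The one-step extensions split into those of product at most `2^r`, which feed the next step
    -- with opposite sign, and the others, which stay in the remainder.
    have h1 : ∑ d ∈ divisorTuples q k (2 ^ r),
        (NProd q d).mulVec (M1Inv.mulVec (GammaVec q P s (∏ i, d i))) =
        ∑ d ∈ divisorTuples q k (2 ^ r), tupleVec q P s d +
        (∑ d ∈ divisorTuples q (k + 1) (2 ^ r), tupleVec q P s d +
        ∑ d ∈ divisorTuples q k (2 ^ r), ∑ e ∈ properDivs q with ¬ (∏ i, d i) * e ≤ 2 ^ r,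
          tupleVec q P s (Fin.snoc d e : Fin (k + 1) → ℕ)) := by
      rw [sum_divisorTuples_succ, ← Finset.sum_add_distrib, ← Finset.sum_add_distrib]
      refine Finset.sum_congr rfl fun d hd => ?_
      rw [tuple_recursion hP hs (mem_divisorTuples.1 hd).1,
        Finset.sum_filter_add_sum_filter_not]
    rw [h1, pow_succ]
    module

end Truncation

/-! ### Bounds for the remainder -/

section Estimates

/-- The bound for the tail over the primes `p ≥ P` at the point `s x`. -/
def tailBound (P s x : ℝ) : ℝ := (1 + P / (s * x - 1)) / P ^ (s * x)

theorem tailBound_nonneg {P s x : ℝ} (hP : 2 ≤ P) (hs : 1 < s) (hx : 1 ≤ x) :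
    0 ≤ tailBound P s x := by
  have : 0 ≤ s * x - 1 := by nlinarith
  have : 0 ≤ P := by linarith
  unfold tailBound
  positivity

theorem tailBound_add_le {P s x : ℝ} (hP : 2 ≤ P) (hs : 1 < s) (hx : 1 ≤ x) (a : ℕ) :
    tailBound P s (x + a) ≤ tailBound P s x * (1 / 2) ^ a := by
  have hx' : 0 < s * x - 1 := by nlinarith
  have ha : (0 : ℝ) ≤ a := Nat.cast_nonneg a
  have hle : s * x - 1 ≤ s * (x + a) - 1 := by nlinarith
  have hP0 : 0 < P := by linarith
  have h1 : 1 + P / (s * (x + a) - 1) ≤ 1 + P / (s * x - 1) := by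
    gcongr
  have h2 : P ^ (s * x) * 2 ^ a ≤ P ^ (s * (x + a)) := by
    rw [mul_add, Real.rpow_add hP0]
    refine mul_le_mul_of_nonneg_left ?_ (by positivity)
    calc (2 : ℝ) ^ a ≤ P ^ a := by gcongr
      _ = P ^ (a : ℝ) := (Real.rpow_natCast _ _).symm
      _ ≤ P ^ (s * a) := Real.rpow_le_rpow_of_exponent_le (by linarith) (by nlinarith)
  have h3 : 0 < P ^ (s * x) := Real.rpow_pos_of_pos hP0 _
  have h4 : 0 ≤ 1 + P / (s * x - 1) := by positivity
  calc tailBound P s (x + a) ≤ (1 + P / (s * x - 1)) / (P ^ (s * x) * 2 ^ a) := by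
        unfold tailBound
        gcongr
    _ = _ := by
        unfold tailBound
        rw [one_div_pow]
        field_simp

theorem tailBound_natCast_le {P s : ℝ} (hP : 2 ≤ P) (hs : 1 < s) {m a n : ℕ} (hm : 1 ≤ m)
    (h : m + a ≤ n) : tailBound P s n ≤ tailBound P s m * (1 / 2) ^ a := by
  have hm' : (1 : ℝ) ≤ m := by exact_mod_cast hm
  obtain ⟨b, rfl⟩ := Nat.exists_eq_add_of_le h
  have h1 := tailBound_add_le hP hs hm' (a + b)
  push_cast at h1 ⊢
  rw [← add_assoc] at h1
  refine h1.trans (mul_le_mul_of_nonneg_left ?_ (tailBound_nonneg hP hs hm'))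
  exact pow_le_pow_of_le_one (by norm_num) (by norm_num) (Nat.le_add_right _ _)

variable {q : ℕ}

theorem card_properDivs : ((properDivs q).card : ℝ) =
    ((Monoid.exponent (ZMod q)ˣ).divisors.card : ℝ) - 1 := by
  have h := Finset.card_erase_add_one
    (Nat.one_mem_divisors.2 (Monoid.exponent_ne_zero_of_finite (G := (ZMod q)ˣ)))
  rw [← h]
  push_cast
  ring

/-- Only `e = 2` exceeds `1/3`, by `1/6`, and the missing divisor `1` pays for it. Having `1/3` in
place of `1/2` gains `(2/3)^k` in the final bound. -/
theorem sum_inv_properDivs_le : ∑ e ∈ properDivs q, (e : ℝ)⁻¹ ≤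
    ((Monoid.exponent (ZMod q)ˣ).divisors.card : ℝ) / 3 := by
  have h1 : ∑ e ∈ properDivs q, (e : ℝ)⁻¹ ≤
      ∑ e ∈ properDivs q, (1 / 3 + if e = 2 then 1 / 6 else 0 : ℝ) := by
    refine Finset.sum_le_sum fun e he => ?_
    have h2 := two_le_of_mem_properDivs he
    split_ifs with h
    · rw [h]; norm_num
    · have : (3 : ℝ) ≤ e := by exact_mod_cast (by omega : 3 ≤ e)
      rw [add_zero, one_div]
      gcongr
  refine h1.trans ?_
  rw [Finset.sum_add_distrib, Finset.sum_const, nsmul_eq_mul, card_properDivs, Finset.sum_ite_eq']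
  split_ifs <;> linarith

theorem sum_geometric_properDivs_le :
    ∑ e ∈ properDivs q, (e : ℝ)⁻¹ * (1 / 4) ^ (e - 2) ≤ 2 / 3 := by
  have hsum : Summable fun j : ℕ => (1 / 2 : ℝ) * (1 / 4) ^ j :=
    (summable_geometric_of_lt_one (by norm_num) (by norm_num)).mul_left _
  have h1 : ∑ e ∈ properDivs q, (e : ℝ)⁻¹ * (1 / 4) ^ (e - 2) ≤
      ∑ e ∈ properDivs q, (1 / 2 : ℝ) * (1 / 4) ^ (e - 2) := by
    refine Finset.sum_le_sum fun e he => ?_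
    have : (2 : ℝ) ≤ e := by exact_mod_cast two_le_of_mem_properDivs he
    rw [one_div 2]
    gcongr
  have hinj : Set.InjOn (fun e => e - 2) (properDivs q : Set ℕ) := by
    intro e he e' he' h
    have := two_le_of_mem_properDivs he
    have := two_le_of_mem_properDivs he'
    simp only at h
    omega
  rw [← Finset.sum_image (f := fun j => (1 / 2 : ℝ) * (1 / 4) ^ j) hinj] at h1
  refine h1.trans ((hsum.sum_le_tsum _ fun _ _ => by positivity).trans_eq ?_)
  rw [tsum_mul_left, tsum_geometric_of_lt_one (by norm_num) (by norm_num)]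
  norm_num

theorem sum_divisorTuples_prod_inv_le (v z : ℕ) :
    ∑ d ∈ divisorTuples q v z, ∏ i, (d i : ℝ)⁻¹ ≤
      (((Monoid.exponent (ZMod q)ˣ).divisors.card : ℝ) / 3) ^ v := by
  calc ∑ d ∈ divisorTuples q v z, ∏ i, (d i : ℝ)⁻¹
      ≤ ∑ d ∈ Fintype.piFinset fun _ : Fin v => properDivs q, ∏ i, (d i : ℝ)⁻¹ :=
        Finset.sum_le_sum_of_subset_of_nonneg (Finset.filter_subset _ _)
          fun _ _ _ => by positivity
    _ = (∑ e ∈ properDivs q, (e : ℝ)⁻¹) ^ v := by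
        rw [Finset.sum_prod_piFinset (properDivs q) fun (_ : Fin v) (e : ℕ) => (e : ℝ)⁻¹,
          Finset.prod_const, Finset.card_univ, Fintype.card_fin]
    _ ≤ _ := by
        gcongr
        exact sum_inv_properDivs_le

theorem snoc_mem_properDivs {v : ℕ} {d : Fin v → ℕ} (hd : ∀ i, d i ∈ properDivs q) {e : ℕ}
    (he : e ∈ properDivs q) (i : Fin (v + 1)) :
    (Fin.snoc d e : Fin (v + 1) → ℕ) i ∈ properDivs q := by
  refine Fin.lastCases ?_ (fun j => ?_) i
  · simpa using he
  · simpa using hd j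

theorem abs_NClass_le_one {G : Type} [CommGroup G] [Finite G] {d : ℕ} (hd : d ≠ 0)
    (A B : LatticeClass G) :
    |NClass d A B| ≤ 1 :=
  abs_N_le_one (classEquiv A) (classEquiv B) d hd

variable [NeZero q]

/-- A product of `v + 1` matrices has only `v` inner summation indices, hence the exponent `v`. -/
theorem abs_NProd_le {v : ℕ} {d : Fin (v + 1) → ℕ} (hd : ∀ i, d i ≠ 0)
    (A B : LatticeClass (ZMod q)ˣ) :
    |NProd q d A B| ≤ (Fintype.card (LatticeClass (ZMod q)ˣ) : ℝ) ^ v * ∏ i, (d i : ℝ)⁻¹ := by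
  induction v generalizing A B with
  | zero =>
    have h := abs_NClass_le_one (hd 0) A B
    have h1 : NProd q d A B = (d 0 : ℝ)⁻¹ * NClass (G := (ZMod q)ˣ) (d 0) A B := by
      simp [NProd]
    rw [h1, abs_mul, abs_of_nonneg (by positivity)]
    rw [pow_zero, one_mul, Fin.prod_univ_castSucc, Fin.prod_univ_zero, one_mul]
    exact mul_le_of_le_one_right (inv_nonneg.2 (Nat.cast_nonneg _)) h
  | succ v ih =>
    have h0 : d = (Fin.snoc (fun i => d i.castSucc) (d (Fin.last _)) : Fin (v + 2) → ℕ) :=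
      (Fin.snoc_init_self d).symm
    have h1 : NProd q d A B = ∑ C, NProd q (fun i : Fin (v + 1) => d i.castSucc) A C *
        ((d (Fin.last _) : ℝ)⁻¹ * NClass (G := (ZMod q)ˣ) (d (Fin.last _)) C B) := by
      conv_lhs => rw [h0, NProd_snoc, Matrix.mul_apply]
      rfl
    rw [h1]
    refine (Finset.abs_sum_le_sum_abs _ _).trans ?_
    refine (Finset.sum_le_card_nsmul _ _ ((Fintype.card (LatticeClass (ZMod q)ˣ) : ℝ) ^ v *
      ∏ i, (d i : ℝ)⁻¹) fun C _ => ?_).trans_eq ?_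
    · rw [abs_mul, abs_mul, abs_of_nonneg (by positivity : (0 : ℝ) ≤ (d (Fin.last _) : ℝ)⁻¹),
        Fin.prod_univ_castSucc, ← mul_assoc (_ ^ v)]
      refine mul_le_mul (ih (fun i => hd i.castSucc) A C) ?_ (by positivity) (by positivity)
      exact mul_le_of_le_one_right (inv_nonneg.2 (Nat.cast_nonneg _))
        (abs_NClass_le_one (hd _) C B)
    · rw [Finset.card_univ, nsmul_eq_mul, pow_succ]
      ring

theorem norm_tupleVec_le {P : ℝ} (hP : 2 ≤ P) {s : ℝ} (hs : 1 < s) {v : ℕ} {d : Fin (v + 1) → ℕ}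
    (hd : ∀ i, d i ∈ properDivs q) :
    ‖tupleVec q P s d‖ ≤ (Fintype.card (LatticeClass (ZMod q)ˣ) : ℝ) ^ v * (∏ i, (d i : ℝ)⁻¹) *
      tailBound P s (∏ i, d i : ℕ) := by
  have hpos : 0 < ∏ i, d i := (pow_pos two_pos _).trans_le (two_pow_le_prod hd)
  have h1 : (1 : ℝ) ≤ (∏ i, d i : ℕ) := by exact_mod_cast hpos
  have hσ := one_lt_natCast_mul hpos hs
  have hd0 : ∀ i, d i ≠ 0 := fun i => by have := two_le_of_mem_properDivs (hd i); omega
  refine (pi_norm_le_iff_of_nonneg (mul_nonneg (by positivity) (tailBound_nonneg hP hs h1))).2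
    fun A => ?_
  rw [Real.norm_eq_abs]
  refine (Finset.abs_sum_le_sum_abs _ _).trans ?_
  have h2 := sum_VVec_le (q := q) hP hσ
  rw [mul_comm _ s] at h2
  refine le_trans ?_ (mul_le_mul_of_nonneg_left h2 (by positivity))
  rw [Finset.mul_sum, mul_comm s]
  refine Finset.sum_le_sum fun B _ => ?_
  change |NProd q d A B * VVec q P _ B| ≤ _
  rw [abs_mul, abs_of_nonneg (VVec_nonneg B hP hσ)]
  exact mul_le_mul_of_nonneg_right (abs_NProd_le hd0 A B) (VVec_nonneg B hP hσ)

/-- The tuples of the largest length. -/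
theorem sum_norm_long_le {P : ℝ} (hP : 2 ≤ P) {s : ℝ} (hs : 1 < s) {k : ℕ} (hk : 1 ≤ k) (z : ℕ) :
    ∑ d ∈ divisorTuples q k z, ∑ e ∈ properDivs q,
      ‖tupleVec q P s (Fin.snoc d e : Fin (k + 1) → ℕ)‖ ≤
    1 / 2 * ((Fintype.card (LatticeClass (ZMod q)ˣ) : ℝ) *
      ((Monoid.exponent (ZMod q)ˣ).divisors.card : ℝ) / 2) ^ k * tailBound P s (2 ^ (k + 1)) := by
  set n := (Fintype.card (LatticeClass (ZMod q)ˣ) : ℝ) with hn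
  set D := ((Monoid.exponent (ZMod q)ˣ).divisors.card : ℝ) with hD
  have hn0 : 0 ≤ n := Nat.cast_nonneg _
  have hD0 : 0 ≤ D := Nat.cast_nonneg _
  set h := tailBound P s (2 ^ (k + 1)) with hh
  have hh0 : 0 ≤ h := tailBound_nonneg hP hs (one_le_pow₀ (by norm_num))
  have hterm : ∀ d ∈ divisorTuples q k z, ∀ e ∈ properDivs q,
      ‖tupleVec q P s (Fin.snoc d e : Fin (k + 1) → ℕ)‖ ≤
        n ^ k * h * ((∏ i, (d i : ℝ)⁻¹) * ((e : ℝ)⁻¹ * (1 / 4) ^ (e - 2))) := by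
    intro d hd e he
    have hd' := (mem_divisorTuples.1 hd).1
    refine (norm_tupleVec_le hP hs (snoc_mem_properDivs hd' he)).trans ?_
    have he2 := two_le_of_mem_properDivs he
    -- With `e = 2 + f`, the product is at least `2^(k+1) + 2^k f`, and `2^k ≥ 2`. The excess `2(e -
    -- 2)` yields the factor `(1/4)^(e-2)`, which makes the sum over `e` bounded independently of
    -- the number of divisors.
    have h1 : 2 ^ (k + 1) + 2 * (e - 2) ≤ (∏ i, d i) * e := by
      have h2 := two_pow_le_prod hd'
      have h3 : 2 ≤ 2 ^ k := by simpa using Nat.pow_le_pow_right two_pos hk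
      obtain ⟨f, rfl⟩ := Nat.exists_eq_add_of_le he2
      rw [Nat.add_sub_cancel_left, pow_succ]
      nlinarith [Nat.mul_le_mul_right f h2, Nat.mul_le_mul_right f h3]
    have h4 := tailBound_natCast_le hP hs Nat.one_le_two_pow h1
    rw [Nat.cast_pow, Nat.cast_ofNat, ← hh, pow_mul] at h4
    rw [prod_snoc', Fin.prod_univ_castSucc]
    simp only [Fin.snoc_castSucc, Fin.snoc_last]
    refine (mul_le_mul_of_nonneg_left h4 (by positivity)).trans_eq ?_
    norm_num
    ring
  calc _ ≤ ∑ d ∈ divisorTuples q k z, ∑ e ∈ properDivs q,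
        n ^ k * h * ((∏ i, (d i : ℝ)⁻¹) * ((e : ℝ)⁻¹ * (1 / 4) ^ (e - 2))) :=
        Finset.sum_le_sum fun d hd => Finset.sum_le_sum fun e he => hterm d hd e he
    _ = n ^ k * h * ((∑ d ∈ divisorTuples q k z, ∏ i, (d i : ℝ)⁻¹) *
        ∑ e ∈ properDivs q, (e : ℝ)⁻¹ * (1 / 4) ^ (e - 2)) := by
        rw [Finset.sum_mul_sum, Finset.mul_sum]
        simp_rw [Finset.mul_sum]
    _ ≤ n ^ k * h * ((D / 3) ^ k * (2 / 3)) := by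
        refine mul_le_mul_of_nonneg_left ?_ (by positivity)
        exact mul_le_mul (sum_divisorTuples_prod_inv_le k z) sum_geometric_properDivs_le
          (Finset.sum_nonneg fun _ _ => by positivity) (by positivity)
    _ = ((2 / 3) ^ k * (2 / 3)) * ((n * D / 2) ^ k * h) := by
        rw [show D / 3 = D / 2 * (2 / 3) by ring, mul_pow, show n * D / 2 = n * (D / 2) by ring,
          mul_pow n]
        ring
    -- Since `k ≥ 1`, `(2/3)^(k+1) ≤ 4/9 < 1/2`.
    _ ≤ 1 / 2 * ((n * D / 2) ^ k * h) := by
        refine mul_le_mul_of_nonneg_right ?_ (by positivity)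
        have : (2 / 3 : ℝ) ^ k ≤ (2 / 3) ^ 1 := pow_le_pow_of_le_one (by norm_num) (by norm_num) hk
        linarith
    _ = _ := by ring

/-- The tuples of smaller length whose product exceeds `2 ^ (k + 1)`. -/
theorem sum_norm_short_le {P : ℝ} (hP : 2 ≤ P) {s : ℝ} (hs : 1 < s) {v k : ℕ} (hv : v < k) :
    ∑ d ∈ divisorTuples q v (2 ^ (k + 1)),
      ∑ e ∈ properDivs q with ¬ (∏ i, d i) * e ≤ 2 ^ (k + 1),
        ‖tupleVec q P s (Fin.snoc d e : Fin (v + 1) → ℕ)‖ ≤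
    1 / 2 * (1 / (Fintype.card (LatticeClass (ZMod q)ˣ) : ℝ)) *
      ((Fintype.card (LatticeClass (ZMod q)ˣ) : ℝ) *
      ((Monoid.exponent (ZMod q)ˣ).divisors.card : ℝ) / 2) ^ k * tailBound P s (2 ^ (k + 1)) := by
  set n := (Fintype.card (LatticeClass (ZMod q)ˣ) : ℝ) with hn
  set D := ((Monoid.exponent (ZMod q)ˣ).divisors.card : ℝ) with hD
  have hn1 : 1 ≤ n := by
    rw [hn, Nat.one_le_cast]
    exact Fintype.card_pos_iff.2 ⟨classOf 1⟩
  have hcard : ((properDivs q).card : ℝ) = D - 1 := card_properDivs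
  have hD1 : 1 ≤ D := by
    have : (0 : ℝ) ≤ (properDivs q).card := Nat.cast_nonneg _
    linarith
  set h := tailBound P s (2 ^ (k + 1)) with hh
  have hh0 : 0 ≤ h := tailBound_nonneg hP hs (one_le_pow₀ (by norm_num))
  -- Here the product exceeds `2^(k+1)`, so the weight `∏ 1/dᵢ` itself supplies `2^{-(k+1)}`, that
  -- is, the `1/2` and the `2^{-k}` of the bound.
  have hterm : ∀ d ∈ divisorTuples q v (2 ^ (k + 1)),
      ∀ e ∈ (properDivs q).filter fun e => ¬ (∏ i, d i) * e ≤ 2 ^ (k + 1),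
      ‖tupleVec q P s (Fin.snoc d e : Fin (v + 1) → ℕ)‖ ≤ n ^ v * ((2 : ℝ) ^ (k + 1))⁻¹ * h := by
    intro d hd e he
    have hd' := (mem_divisorTuples.1 hd).1
    obtain ⟨he, hlt⟩ := Finset.mem_filter.1 he
    push Not at hlt
    refine (norm_tupleVec_le hP hs (snoc_mem_properDivs hd' he)).trans ?_
    have h4 := tailBound_natCast_le hP hs (a := 0) Nat.one_le_two_pow hlt.le
    rw [Nat.cast_pow, Nat.cast_ofNat, ← hh, pow_zero, mul_one] at h4
    rw [Finset.prod_inv_distrib, ← Nat.cast_prod, prod_snoc']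
    have h5 : (2 : ℝ) ^ (k + 1) ≤ ((∏ i, d i) * e : ℕ) := by exact_mod_cast hlt.le
    refine mul_le_mul (mul_le_mul_of_nonneg_left ?_ (by positivity)) h4
      (tailBound_nonneg hP hs (le_trans (one_le_pow₀ (by norm_num)) h5)) (by positivity)
    gcongr
  calc _ ≤ ∑ d ∈ divisorTuples q v (2 ^ (k + 1)), (D - 1) * (n ^ v * ((2 : ℝ) ^ (k + 1))⁻¹ * h) := by
        refine Finset.sum_le_sum fun d hd => ?_
        refine (Finset.sum_le_card_nsmul _ _ _ (hterm d hd)).trans ?_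
        rw [nsmul_eq_mul, ← hcard]
        refine mul_le_mul_of_nonneg_right ?_ (by positivity)
        exact_mod_cast Finset.card_filter_le _ _
    _ ≤ (D - 1) ^ v * ((D - 1) * (n ^ v * ((2 : ℝ) ^ (k + 1))⁻¹ * h)) := by
        rw [Finset.sum_const, nsmul_eq_mul]
        refine mul_le_mul_of_nonneg_right ?_
          (mul_nonneg (by linarith) (by positivity))
        rw [← hcard]
        have : (divisorTuples q v (2 ^ (k + 1))).card ≤ (properDivs q).card ^ v := by
          refine (Finset.card_filter_le _ _).trans_eq ?_
          rw [Fintype.card_piFinset, Finset.prod_const, Finset.card_univ, Fintype.card_fin]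
        exact_mod_cast this
    _ = (D - 1) ^ (v + 1) * n ^ v * (((2 : ℝ) ^ (k + 1))⁻¹ * h) := by ring
    -- From `v ≤ k - 1`; the missing power of `n` is the factor `1/n` of the bound.
    _ ≤ D ^ k * n ^ (k - 1) * (((2 : ℝ) ^ (k + 1))⁻¹ * h) := by
        refine mul_le_mul_of_nonneg_right (mul_le_mul ?_ ?_ (by positivity) (by positivity))
          (by positivity)
        · exact (pow_le_pow_left₀ (by linarith) (by linarith) _).trans (pow_le_pow_right₀ hD1 hv)
        · exact pow_le_pow_right₀ hn1 (by omega)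
    _ = _ := by
        obtain ⟨j, rfl⟩ := Nat.exists_eq_add_of_le' (Nat.succ_le_of_lt (Nat.zero_lt_of_lt hv))
        have : n ≠ 0 := by linarith
        rw [Nat.add_sub_cancel, div_pow, mul_pow]
        field_simp
        ring

end Estimates

/-! ### Assembling the bound -/

section Main

variable {q : ℕ} [NeZero q]

theorem norm_VVec_sub_approx_le {P : ℝ} (hP : 2 ≤ P) {s : ℝ} (hs : 1 < s) {k : ℕ} (hk : 1 ≤ k) :
    ‖VVec q P s - approx q P s (k + 1)‖ ≤
      1 / 2 * (1 + (k : ℝ) / (Fintype.card (LatticeClass (ZMod q)ˣ) : ℝ)) *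
      ((Fintype.card (LatticeClass (ZMod q)ˣ) : ℝ) *
      ((Monoid.exponent (ZMod q)ˣ).divisors.card : ℝ) / 2) ^ k * tailBound P s (2 ^ (k + 1)) := by
  set z := 2 ^ (k + 1) with hz
  have happ : approx q P s (k + 1) = ∑ v ∈ Finset.range (k + 1), (-1 : ℝ) ^ v •
      ∑ d ∈ divisorTuples q v z,
        (NProd q d).mulVec (M1Inv.mulVec (GammaVec q P s (∏ i, d i))) := by
    refine Finset.sum_congr rfl fun v _ => congrArg _ (Finset.sum_congr rfl fun d _ => ?_)
    rw [Matrix.mulVec_mulVec]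
    rfl
  set R : ℕ → LatticeClass (ZMod q)ˣ → ℝ := fun v => ∑ d ∈ divisorTuples q v z,
    ∑ e ∈ properDivs q with ¬ (∏ i, d i) * e ≤ z,
      tupleVec q P s (Fin.snoc d e : Fin (v + 1) → ℕ) with hR
  set T := ∑ d ∈ divisorTuples q (k + 1) z, tupleVec q P s d with hT
  have h1 : VVec q P s - approx q P s (k + 1) = (-1 : ℝ) ^ (k + 1) • T -
      ∑ v ∈ Finset.range (k + 1), (-1 : ℝ) ^ v • R v := by
    rw [happ]
    exact VVec_sub_approx hP hs (k + 1) (k + 1)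
  -- `T` and the last boundary term carry the same sign, and together they run over all one-step
  -- extensions of the tuples of length `k`. Estimating them jointly leaves only `k = r - 1`
  -- boundary terms.
  have h2 : VVec q P s - approx q P s (k + 1) = (-1 : ℝ) ^ (k + 1) • (T + R k) -
      ∑ v ∈ Finset.range k, (-1 : ℝ) ^ v • R v := by
    rw [h1, Finset.sum_range_succ, pow_succ]
    module
  have h3 : ‖T + R k‖ ≤ ∑ d ∈ divisorTuples q k z, ∑ e ∈ properDivs q,
      ‖tupleVec q P s (Fin.snoc d e : Fin (k + 1) → ℕ)‖ := by
    rw [hT, hR, sum_divisorTuples_succ, ← Finset.sum_add_distrib]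
    simp_rw [Finset.sum_filter_add_sum_filter_not]
    exact (norm_sum_le _ _).trans (Finset.sum_le_sum fun d _ => norm_sum_le _ _)
  set b := ((Fintype.card (LatticeClass (ZMod q)ˣ) : ℝ) *
      ((Monoid.exponent (ZMod q)ˣ).divisors.card : ℝ) / 2) ^ k with hb
  have h4 : ∀ v ∈ Finset.range k, ‖(-1 : ℝ) ^ v • R v‖ ≤
      1 / 2 * (1 / (Fintype.card (LatticeClass (ZMod q)ˣ) : ℝ)) * b *
        tailBound P s (2 ^ (k + 1)) := fun v hv => by
    rw [norm_smul, norm_pow, norm_neg, norm_one, one_pow, one_mul]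
    exact ((norm_sum_le _ _).trans (Finset.sum_le_sum fun d _ => norm_sum_le _ _)).trans
      (sum_norm_short_le hP hs (Finset.mem_range.1 hv))
  have h5 : ‖(-1 : ℝ) ^ (k + 1) • (T + R k)‖ ≤ 1 / 2 * b * tailBound P s (2 ^ (k + 1)) := by
    rw [norm_smul, norm_pow, norm_neg, norm_one, one_pow, one_mul]
    exact h3.trans (sum_norm_long_le hP hs hk z)
  have h6 := (norm_sum_le _ _).trans (Finset.sum_le_card_nsmul _ _ _ h4)
  rw [h2]
  refine (norm_sub_le _ _).trans ((add_le_add h5 h6).trans_eq ?_)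
  rw [Finset.card_range, nsmul_eq_mul]
  ring

end Main

end LatticeEuler

end

theorem mainTheorem1 (q : ℕ) [NeZero q] (hq : 1 < q) (s : ℝ) (hs : 1 < s) (P : ℝ) (hP : 2 ≤ P) :
    -- the Euler products involved converge, and the products of L-values are positive reals
    (∀ A : LatticeEuler.LatticeClass (ZMod q)ˣ,
      Multipliable fun p : LatticeEuler.PrimeGEIn P q A.1 => LatticeEuler.zetaFactor s p.1) ∧
    (∀ (χ : DirichletCharacter ℂ q) (t : ℕ), 1 ≤ t →
      Multipliable fun p : LatticeEuler.PrimeGE P =>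
        LatticeEuler.LFactor χ (((t : ℝ) * s : ℝ) : ℂ) p.1) ∧
    (∀ (G₀ : Subgroup (ZMod q)ˣ) (t : ℕ), 1 ≤ t →
      (LatticeEuler.LProd P s G₀ t).im = 0 ∧ 0 < (LatticeEuler.LProd P s G₀ t).re) ∧
    -- the approximation
    ∀ r : ℕ, 2 ≤ r →
      ‖LatticeEuler.VVec q P s - LatticeEuler.approx q P s r‖ ≤
        1 / 2 *
          (1 + ((r : ℝ) - 1) / (Fintype.card (LatticeEuler.LatticeClass (ZMod q)ˣ) : ℝ)) *
          ((Fintype.card (LatticeEuler.LatticeClass (ZMod q)ˣ) : ℝ) *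
            ((Monoid.exponent (ZMod q)ˣ).divisors.card : ℝ) / 2) ^ (r - 1) *
          ((1 + P / (s * 2 ^ r - 1)) / P ^ (s * 2 ^ r)) := by
  refine ⟨fun A => LatticeEuler.multipliable_zetaFactor A.1 hP hs, fun χ t ht =>
    LatticeEuler.multipliable_LFactor χ P (LatticeEuler.one_lt_natCast_mul ht hs),
    fun G₀ t ht => ?_, fun r hr => ?_⟩
  · rw [LatticeEuler.LProd_eq_exp G₀ hP hs ht]
    exact ⟨Complex.ofReal_im _, by rw [Complex.ofReal_re]; exact Real.exp_pos _⟩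
  · obtain ⟨k, rfl⟩ := Nat.exists_eq_add_of_le' (one_le_two.trans hr)
    have h := LatticeEuler.norm_VVec_sub_approx_le (q := q) hP hs (k := k) (by omega)
    rw [Nat.add_sub_cancel, Nat.cast_add, Nat.cast_one, add_sub_cancel_right]
    exact h
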